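/- \textbf{Conventions.} A compact set $K\subseteq\mathbb C$ is called simply connected if $K$ and $\mathbb C\setminus K$ are connected (so that $\widehat{\mathbb C}\setminus K$ is a simply connected domain). \emph{Faber polynomials.} Let $\Omega$ be a simply connected compact set, not a single point, with exterior Riemann mapping $\widetilde\Phi:\widehat{\mathbb C}\setminus\Omega\to\{w\in\widehat{\mathbb C}:|w|>1\}$, $\widetilde\Phi(\infty)=\infty$, $\widetilde\Phi'(\infty)=\lim_{z\to\infty}\widetilde\Phi(z)/z>0$. The $k$th Faber polynomial $F_k$ of $\Omega$ is the polynomial with $F_k(z)=\frac1{2\pi i}\oint_{|\zeta|=R}\frac{\widetilde\Phi(\zeta)^k}{\zeta-z}\,d\zeta$ for every $z$ and every $R$ such that $|\zeta|<R$ contains $\Omega\cup\{z\}$. \emph{Faber--Walsh polynomials.} Let $E$ be the union of $N\ge1$ pairwise disjoint simply connected compact sets, none a single point. The lemniscatic map of $E$ is the bijective conformal map $\Phi$ from $\widehat{\mathbb C}\setminus E$ onto a lemniscatic domain $\mathcal L=\{w\in\widehat{\mathbb C}:\prod_{j=1}^N|w-c_j|^{m_j}>\mu\}$, with distinct foci $c_1,\dots,c_N\in\mathbb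 C$, exponents $m_j>0$, $\sum_j m_j=1$, and $\mu>0$, such that $\Phi(z)=z+O(1/z)$ at $\infty$. A sequence $(\alpha_j)_{j\ge1}$ of foci is admissible if there is $A>0$ such that for all $j$ and all $k\ge1$ the number of occurrences of $c_j$ in $\alpha_1,\dots,\alpha_k$ differs from $km_j$ by at most $A$. With $u_k(w)=\prod_{j=1}^k(w-\alpha_j)$, the $k$th Faber--Walsh polynomial for $E$ and an admissible sequence $(\alpha_j)$ is the polynomial $b_k$ with $b_k(z)=\frac1{2\pi i}\oint_{|\zeta|=R}\frac{u_k(\Phi(\zeta))}{\zeta-z}\,d\zeta$ for every $z$ and every $R$ such that $|\zeta|<R$ contains $E\cup\{z\}$. \textbf{Theorem.} Let $\Omega\subseteq\mathbb C$ be a simply connected compact set, not a single point, with $\Omega=\Omega^*:=\{\overline z:z\in\Omega\}$, and let $\widetilde\Phi$ be its exterior Riemann mapping as above. Let $P(z)=\alpha z^n+\alpha_0$ with $\alpha>0$, $n\ge2$, $\alpha_0\in\mathbb R$ and $\alpha_0<\min(\Omega\cap\mathbb R)$, let $E=P^{-1}(\Omega)$, $\mu=\big(1/(\alpha\widetilde\Phi'(\infty))\big)^{1/n}$,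 and let $a_1,\dots,a_n$ be the $n$ distinct roots of $w^n+\mu^n\widetilde\Phi(P(0))$, in any order. Then, for every $k\ge0$, the $k$th Faber polynomial $F_k$ of $\Omega$ exists, and the $(kn)$th Faber--Walsh polynomial $b_{kn}$ for $E$ and the sequence $(a_1,\dots,a_n,a_1,\dots,a_n,\dots)$ exists and is $$b_{kn}(z)=\frac1{(\alpha\widetilde\Phi'(\infty))^k}\,F_k(P(z)).$$ -/

import Mathlib

open Polynomial

/-- A compact set `K ⊆ ℂ` that is simply connected in the sense used for plane compacta: `K` is
connected and its complement is connected, i.e. the complement of `K` in the Riemann sphere is a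
simply connected domain. -/
structure IsSimplyConnectedCompact (K : Set ℂ) : Prop where
  isCompact : IsCompact K
  isConnected : IsConnected K
  isConnected_compl : IsConnected Kᶜ

/-- `φ` is the exterior Riemann mapping of `Ω`: a bijective conformal map from the complement of
`Ω` onto `{w : |w| > 1}` with `φ(∞) = ∞` and `φ'(∞) = lim φ(z)/z = c > 0`. (The existence of the
positive limit forces `φ(∞) = ∞`; the point at infinity is otherwise left out of domain and
range.) -/
structure IsExteriorRiemannMap (Ω : Set ℂ) (φ : ℂ → ℂ) (c : ℝ) : Prop where
  differentiableOn : DifferentiableOn ℂ φ Ωᶜ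
  bijOn : Set.BijOn φ Ωᶜ {w : ℂ | 1 < ‖w‖}
  tendsto_div : Filter.Tendsto (fun z : ℂ => φ z / z) (Bornology.cobounded ℂ) (nhds (c : ℂ))
  pos : 0 < c

/-- The polynomial `F` is the `k`-th Faber polynomial of `Ω` formed with the exterior Riemann
mapping `φ`: `F(z) = (1/2πi) ∮ φ(ζ)^k / (ζ - z) dζ`, taken over any positively oriented circle
`|ζ| = R` that encloses `Ω` and `z`. (The integrand is holomorphic in `ζ ∉ Ω ∪ {z}`, and such a
circle is homologous there to every level curve of `|φ|` that encloses `z`.) -/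
def IsFaberPolynomial (Ω : Set ℂ) (φ : ℂ → ℂ) (k : ℕ) (F : ℂ[X]) : Prop :=
  ∀ (z : ℂ) (R : ℝ), Ω ⊆ Metric.ball 0 R → z ∈ Metric.ball (0 : ℂ) R →
    F.eval z = (2 * (Real.pi : ℂ) * Complex.I)⁻¹ * ∮ ζ in C(0, R), φ ζ ^ k / (ζ - z)

/-- The finite part of the lemniscatic domain `{w : |U(w)| > μ}`, where
`U(w) = ∏ j, (w - a j) ^ m j`. -/
def lemniscaticDomain {N : ℕ} (a : Fin N → ℂ) (m : Fin N → ℝ) (μ : ℝ) : Set ℂ :=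
  {w : ℂ | μ < ∏ j, ‖w - a j‖ ^ m j}

/-- `E` is the union of `N` mutually exterior simply connected compact sets, none a single point,
and `Φ` is the lemniscatic map of `E`: a bijective conformal map from the complement of `E` onto
the lemniscatic domain with `N` distinct foci `a j`, exponents `m j > 0` of sum `1` and `μ > 0`,
with `Φ(z) = z + O(1/z)` at infinity. -/
structure IsLemniscaticMap (E : Set ℂ) {N : ℕ} (a : Fin N → ℂ) (m : Fin N → ℝ) (μ : ℝ)
    (Φ : ℂ → ℂ) : Prop where
  components : ∃ K : Fin N → Set ℂ, (∀ j, IsSimplyConnectedCompact (K j)) ∧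
    (∀ j, (K j).Nontrivial) ∧ Pairwise (fun i j => Disjoint (K i) (K j)) ∧ E = ⋃ j, K j
  foci_injective : Function.Injective a
  exponent_pos : ∀ j, 0 < m j
  exponent_sum : ∑ j, m j = 1
  mu_pos : 0 < μ
  differentiableOn : DifferentiableOn ℂ Φ Eᶜ
  bijOn : Set.BijOn Φ Eᶜ (lemniscaticDomain a m μ)
  isBigO : (fun z : ℂ => Φ z - z) =O[Bornology.cobounded ℂ] fun z : ℂ => z⁻¹

/-- An admissible sequence of foci, indexed from `0`: every term of `s` is one of the foci, and
the number of occurrences of `a j` among the first `k` terms differs from `k * m j` by at most a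
constant. -/
def IsAdmissibleSequence {N : ℕ} (a : Fin N → ℂ) (m : Fin N → ℝ) (s : ℕ → ℂ) : Prop :=
  (∀ i, ∃ j, s i = a j) ∧
    ∃ A : ℝ, 0 < A ∧ ∀ (j : Fin N) (k : ℕ), 1 ≤ k →
      |(Nat.card {i : ℕ // i < k ∧ s i = a j} : ℝ) - k * m j| ≤ A

/-- The polynomial `b` is the `k`-th Faber--Walsh polynomial for `E` and the sequence `s`: with
the lemniscatic map `Φ` of `E`, for whose lemniscatic domain `s` is admissible, and
`u_k(w) = ∏ i < k, (w - s i)`, one has `b(z) = (1/2πi) ∮ u_k(Φ(ζ)) / (ζ - z) dζ`, taken over any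
positively oriented circle `|ζ| = R` that encloses `E` and `z`. (The integrand is holomorphic in
`ζ ∉ E ∪ {z}`, and such a circle is homologous there to every level curve of the Green's function
of the complement of `E` that encloses `z`.) -/
def IsFaberWalshPolynomial (E : Set ℂ) (s : ℕ → ℂ) (k : ℕ) (b : ℂ[X]) : Prop :=
  ∃ (N : ℕ) (a : Fin N → ℂ) (m : Fin N → ℝ) (μ : ℝ) (Φ : ℂ → ℂ),
    IsLemniscaticMap E a m μ Φ ∧ IsAdmissibleSequence a m s ∧
    ∀ (z : ℂ) (R : ℝ), E ⊆ Metric.ball 0 R → z ∈ Metric.ball (0 : ℂ) R →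
      b.eval z = (2 * (Real.pi : ℂ) * Complex.I)⁻¹ *
        ∮ ζ in C(0, R), (∏ i ∈ Finset.range k, (Φ ζ - s i)) / (ζ - z)

/-- The periodic sequence `(a 0, …, a (n-1), a 0, …, a (n-1), …)`. -/
def cyclicSequence {n : ℕ} (hn : 0 < n) (a : Fin n → ℂ) (i : ℕ) : ℂ :=
  a ⟨i % n, Nat.mod_lt i hn⟩

/-! Write `c` for the derivative of `φ` at infinity and `β = -(μ ^ n * φ α₀)`, so that the `a j` are
the `n`-th roots of `β` and `μ ^ n = 1 / (α * c)`. The heart of the matter is the identity `Φ z ^ n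
- β = φ (P z) / (α * c)` off `E` for a lemniscatic map `Φ` of `E`. The left side is the product of
the `Φ z - a j`, so one turn through the cyclic sequence contributes one factor `φ ∘ P`, and `k`
turns give `u_{kn} ∘ Φ = (α * c)⁻ᵏ * (φ ∘ P) ^ k`. Near infinity `φ ^ k` is `F_k + O(1/z)`;
composing with `P` keeps the error `O(1/z)`. The Cauchy integral over a large circle returns exactly
the polynomial part, which is `(α * c)⁻ᵏ * F_k ∘ P`.

Uniqueness (`pow_sub_eq_of_lemniscaticDomain_eq`): counting frequencies shows that admissibility of
the cyclic sequence forces the foci to be the `a j` and the exponents to be `1 / n`, so the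
lemniscatic domain is `ν ^ n < |w ^ n - β|` for some `ν`. Then `(Φ ^ n - β) / (φ ∘ P)` has no zeros,
has modulus tending to `ν ^ n` at `E`, and tends to `1 / (α * c)` at infinity. The maximum principle
for it and for its reciprocal makes it constant.

Existence (`exists_isLemniscaticMap_preimage`): solving the identity for `Φ` requires an `n`-th root
of `φ (P z) - φ α₀`. Since `P z - α₀ = α * z ^ n`, it suffices to take a root `g` of the slope of
`φ` at `α₀`, which exists because `1 / φ` carries the exterior of `Ω` to a disc; then `Φ z = z * g
(P z)`. As `Ω` misses the real ray up to `α₀`, the principal root is continuous on it and `E` splits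
into `n` rotated copies of one branch. -/

open Filter Topology Bornology Set

/-! ### Inverses of univalent functions -/

/-- An injective holomorphic function is open at every point of its domain. -/
theorem nhds_le_map_of_injOn {f : ℂ → ℂ} {U : Set ℂ} (hU : IsOpen U)
    (hf : DifferentiableOn ℂ f U) (hinj : InjOn f U) {z : ℂ} (hz : z ∈ U) :
    𝓝 (f z) ≤ map f (𝓝 z) := by
  refine ((hf.analyticAt (hU.mem_nhds hz)).eventually_constant_or_nhds_le_map_nhds).resolve_left
    fun h => ?_
  have h1 : ∀ᶠ w in 𝓝[≠] z, f w = f z ∧ w ∈ U ∧ w ≠ z :=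
    (h.filter_mono nhdsWithin_le_nhds).and
      (((hU.eventually_mem hz).filter_mono nhdsWithin_le_nhds).and
        self_mem_nhdsWithin)
  obtain ⟨w, h2, h3, h4⟩ := h1.exists
  exact h4 (hinj h3 hz h2)

theorem isOpen_image_of_injOn {f : ℂ → ℂ} {U : Set ℂ} (hU : IsOpen U)
    (hf : DifferentiableOn ℂ f U) (hinj : InjOn f U) : IsOpen (f '' U) := by
  rw [isOpen_iff_mem_nhds]
  rintro _ ⟨z, hz, rfl⟩
  exact nhds_le_map_of_injOn hU hf hinj hz (image_mem_map (hU.mem_nhds hz))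

theorem continuousAt_leftInvOn {f g : ℂ → ℂ} {U : Set ℂ} (hU : IsOpen U)
    (hf : DifferentiableOn ℂ f U) (hg : LeftInvOn g f U) {z : ℂ} (hz : z ∈ U) :
    ContinuousAt g (f z) := by
  have h := nhds_le_map_of_injOn hU hf hg.injOn hz
  have h1 : Tendsto g (map f (𝓝 z)) (𝓝 z) := by
    rw [tendsto_map'_iff]
    refine tendsto_id.congr' ?_
    filter_upwards [hU.mem_nhds hz] with w hw
    exact (hg hw).symm
  rw [ContinuousAt, hg hz]
  exact h1.mono_left h

/-- The zeros of `deriv f` are isolated, since otherwise `f` would be locally constant. Hence `g` is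
differentiable on a punctured neighbourhood of `f z`, and continuity removes the singularity there.
That `deriv f z ≠ 0` is not presupposed; it is deduced from this lemma by the chain rule. -/
theorem analyticAt_leftInvOn {f g : ℂ → ℂ} {U : Set ℂ} (hU : IsOpen U)
    (hf : DifferentiableOn ℂ f U) (hg : LeftInvOn g f U) {z : ℂ} (hz : z ∈ U) :
    AnalyticAt ℂ g (f z) := by
  have hcont := continuousAt_leftInvOn hU hf hg hz
  have hfz := hf.analyticAt (hU.mem_nhds hz)
  have hopen := isOpen_image_of_injOn hU hf hg.injOn
  refine Complex.analyticAt_of_differentiable_on_punctured_nhds_of_continuousAt ?_ hcont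
  have hdne : ∀ᶠ w in 𝓝[≠] z, deriv f w ≠ 0 := by
    refine hfz.deriv.eventually_eq_zero_or_eventually_ne_zero.resolve_left fun h => ?_
    have hconst : ∀ᶠ w in 𝓝 z, f w = f z := by
      obtain ⟨ε, hε, hball⟩ := Metric.eventually_nhds_iff_ball.1
        (h.and (hU.eventually_mem hz))
      filter_upwards [Metric.ball_mem_nhds z hε] with w hw
      refine (convex_ball z ε).is_const_of_fderivWithin_eq_zero (𝕜 := ℂ)
        (hf.mono fun x hx => (hball x hx).2) (fun x hx => ?_) hw (Metric.mem_ball_self hε)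
      rw [fderivWithin_of_isOpen Metric.isOpen_ball hx]
      ext
      simpa using (hball x hx).1
    have h1 := (hconst.and (hU.eventually_mem hz)).filter_mono
      (nhdsWithin_le_nhds (s := {z}ᶜ))
    obtain ⟨w, ⟨h2, h3⟩, h4⟩ := (h1.and self_mem_nhdsWithin).exists
    exact h4 (hg.injOn h3 hz h2)
  have htend : Tendsto g (𝓝[≠] (f z)) (𝓝[≠] z) := by
    refine tendsto_nhdsWithin_iff.2 ⟨?_, ?_⟩
    · simpa [ContinuousAt, hg hz] using hcont.tendsto.mono_left (nhdsWithin_le_nhds (s := {f z}ᶜ))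
    · filter_upwards [self_mem_nhdsWithin,
        nhdsWithin_le_nhds (hopen.mem_nhds (mem_image_of_mem f hz))] with w hw hw'
      obtain ⟨x, hx, rfl⟩ := hw'
      rw [hg hx]
      rintro rfl
      exact hw rfl
  filter_upwards [htend.eventually hdne,
    nhdsWithin_le_nhds (hopen.mem_nhds (mem_image_of_mem f hz))] with w hw hw'
  obtain ⟨x, hx, rfl⟩ := hw'
  rw [hg hx] at hw
  have hd : HasDerivAt f (deriv f x) (g (f x)) := by
    rw [hg hx]
    exact (hf.differentiableAt (hU.mem_nhds hx)).hasDerivAt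
  refine (hd.of_local_left_inverse (continuousAt_leftInvOn hU hf hg hx) hw ?_).differentiableAt
  filter_upwards [hopen.mem_nhds (mem_image_of_mem f hx)] with y hy
  obtain ⟨v, hv, rfl⟩ := hy
  rw [hg hv]

theorem deriv_ne_zero_of_injOn {f : ℂ → ℂ} {U : Set ℂ} (hU : IsOpen U)
    (hf : DifferentiableOn ℂ f U) (hinj : InjOn f U) {z : ℂ} (hz : z ∈ U) : deriv f z ≠ 0 := by
  intro h0
  have hg : LeftInvOn (Function.invFunOn f U) f U := hinj.leftInvOn_invFunOn
  have h1 := (analyticAt_leftInvOn hU hf hg hz).differentiableAt.hasDerivAt.comp z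
    (hf.differentiableAt (hU.mem_nhds hz)).hasDerivAt
  have h2 : HasDerivAt (Function.invFunOn f U ∘ f) 1 z := by
    refine (hasDerivAt_id z).congr_of_eventuallyEq ?_
    filter_upwards [hU.mem_nhds hz] with w hw
    exact hg hw
  have := h1.unique h2
  rw [h0, mul_zero] at this
  exact zero_ne_one this

/-! ### Univalent functions near infinity and near the boundary -/

/-- A function holomorphic near infinity with a finite limit there is analytic at infinity. -/
theorem analyticAt_update_inv {f : ℂ → ℂ} {l : ℂ}
    (hf : ∀ᶠ z in cobounded ℂ, DifferentiableAt ℂ f z) (hl : Tendsto f (cobounded ℂ) (𝓝 l)) :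
    AnalyticAt ℂ (Function.update (fun t => f t⁻¹) 0 l) 0 := by
  refine Complex.analyticAt_of_differentiable_on_punctured_nhds_of_continuousAt ?_ ?_
  · filter_upwards [tendsto_inv₀_nhdsNE_zero.eventually hf, self_mem_nhdsWithin] with t ht ht0
    have h1 : DifferentiableAt ℂ (fun t => f t⁻¹) t :=
      DifferentiableAt.comp t ht (differentiableAt_inv ht0)
    refine h1.congr_of_eventuallyEq ?_
    filter_upwards [isOpen_ne.mem_nhds ht0] with s hs
    rw [Function.update_of_ne hs]
  · rw [continuousAt_update_same]
    exact hl.comp tendsto_inv₀_nhdsNE_zero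

theorem eventually_mem_compl_cobounded {K : Set ℂ} (hK : IsCompact K) :
    ∀ᶠ z in cobounded ℂ, z ∈ Kᶜ :=
  isBounded_def.1 hK.isBounded

theorem eventually_differentiableAt_cobounded {K : Set ℂ} (hK : IsCompact K) {f : ℂ → ℂ}
    (hf : DifferentiableOn ℂ f Kᶜ) : ∀ᶠ z in cobounded ℂ, DifferentiableAt ℂ f z := by
  filter_upwards [eventually_mem_compl_cobounded hK] with z hz
  exact hf.differentiableAt (hK.isClosed.isOpen_compl.mem_nhds hz)

theorem tendsto_cobounded_of_tendsto_div {f : ℂ → ℂ} {c : ℂ} (hc : c ≠ 0)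
    (h : Tendsto (fun z => f z / z) (cobounded ℂ) (𝓝 c)) :
    Tendsto f (cobounded ℂ) (cobounded ℂ) := by
  rw [← tendsto_norm_atTop_iff_cobounded]
  have h1 : Tendsto (fun z : ℂ => ‖f z / z‖ * ‖z‖) (cobounded ℂ) atTop :=
    h.norm.pos_mul_atTop (norm_pos_iff.2 hc) tendsto_norm_cobounded_atTop
  refine h1.congr' ?_
  filter_upwards [eventually_ne_cobounded (0 : ℂ)] with z hz
  rw [← norm_mul, div_mul_cancel₀ _ hz]

/-- A univalent function with a simple pole at infinity is bounded away from infinity. -/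
theorem exists_norm_le_of_injOn {K : Set ℂ} (hK : IsCompact K) {f : ℂ → ℂ} {c : ℂ} (hc : c ≠ 0)
    (hf : DifferentiableOn ℂ f Kᶜ) (hinj : InjOn f Kᶜ)
    (h : Tendsto (fun z => f z / z) (cobounded ℂ) (𝓝 c)) (r : ℝ) :
    ∃ ρ : ℝ, ∀ z ∈ Kᶜ, ‖z‖ ≤ r → ‖f z‖ ≤ ρ := by
  have htop := tendsto_cobounded_of_tendsto_div hc h
  -- This is `1 / f` in the coordinate `t = 1 / z`. It is open at `0`, so every value of `f` of
  -- large modulus is already taken at some point of modulus greater than `r`; injectivity then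
  -- excludes it where `‖z‖ ≤ r`.
  set F : ℂ → ℂ := Function.update (fun t => (f t⁻¹)⁻¹) 0 0 with hF
  have hF0 : F 0 = 0 := by simp [hF]
  have hFne : ∀ t, t ≠ 0 → F t = (f t⁻¹)⁻¹ := fun t ht => by simp [hF, ht]
  have hFa : AnalyticAt ℂ F 0 := by
    refine analyticAt_update_inv (f := fun z => (f z)⁻¹) ?_ (tendsto_inv₀_cobounded.comp htop)
    filter_upwards [eventually_differentiableAt_cobounded hK hf,
      htop.eventually (eventually_ne_cobounded (0 : ℂ))] with z hz hz0
    exact hz.inv hz0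
  have hmap : 𝓝 (F 0) ≤ map F (𝓝 0) := by
    refine hFa.eventually_constant_or_nhds_le_map_nhds.resolve_left fun hconst => ?_
    have h1 : ∀ᶠ t in 𝓝[≠] (0 : ℂ), f t⁻¹ ≠ 0 :=
      (htop.comp tendsto_inv₀_nhdsNE_zero).eventually (eventually_ne_cobounded (0 : ℂ))
    obtain ⟨t, ⟨ht1, ht2⟩, ht3⟩ :=
      ((h1.and (hconst.filter_mono nhdsWithin_le_nhds)).and self_mem_nhdsWithin).exists
    rw [hFne t ht3, hF0, inv_eq_zero] at ht2
    exact ht1 ht2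
  have hev : ∀ᶠ t in 𝓝 (0 : ℂ), t ≠ 0 → t⁻¹ ∈ Kᶜ ∧ r < ‖t⁻¹‖ := by
    refine eventually_nhdsWithin_iff.1 ?_
    exact tendsto_inv₀_nhdsNE_zero.eventually ((eventually_mem_compl_cobounded hK).and
      (tendsto_norm_cobounded_atTop.eventually (eventually_gt_atTop r)))
  have him := hmap (image_mem_map hev)
  rw [hF0] at him
  obtain ⟨δ, hδ, hball⟩ := Metric.mem_nhds_iff.1 him
  refine ⟨δ⁻¹, fun z hz hzr => ?_⟩
  by_contra! hlt
  have hpos : 0 < ‖f z‖ := (inv_pos.2 hδ).trans hlt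
  have hmem : (f z)⁻¹ ∈ Metric.ball (0 : ℂ) δ := by
    rw [mem_ball_zero_iff, norm_inv]
    exact inv_lt_of_inv_lt₀ hδ hlt
  obtain ⟨t, ht, htz⟩ := hball hmem
  have ht0 : t ≠ 0 := by
    rintro rfl
    rw [hF0, eq_comm, inv_eq_zero] at htz
    exact hpos.ne' (by rw [htz, norm_zero])
  obtain ⟨h1, h2⟩ := ht ht0
  rw [hFne t ht0, inv_inj] at htz
  rw [hinj h1 hz htz] at h2
  exact absurd hzr (not_le.2 h2)

/-- A univalent function with a simple pole at infinity leaves closed subsets of its range when its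
argument approaches the boundary of its domain. -/
theorem eventually_notMem_of_injOn {K : Set ℂ} (hK : IsCompact K) {f : ℂ → ℂ} {c : ℂ} (hc : c ≠ 0)
    (hf : DifferentiableOn ℂ f Kᶜ) (hinj : InjOn f Kᶜ)
    (h : Tendsto (fun z => f z / z) (cobounded ℂ) (𝓝 c)) {S : Set ℂ} (hS : IsClosed S)
    (hSf : S ⊆ f '' Kᶜ) {e : ℂ} (he : e ∈ K) : ∀ᶠ z in 𝓝[Kᶜ] e, f z ∉ S := by
  have hU := hK.isClosed.isOpen_compl
  obtain ⟨ρ, hρ⟩ := exists_norm_le_of_injOn hK hc hf hinj h (‖e‖ + 1)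
  have hg : LeftInvOn (Function.invFunOn f Kᶜ) f Kᶜ := hinj.leftInvOn_invFunOn
  -- Near `e` the values of `f` are bounded by `ρ`, so a value in `S` would put `z` in this compact
  -- set, which misses `e`.
  have hcomp : IsCompact (Function.invFunOn f Kᶜ '' (S ∩ Metric.closedBall 0 ρ)) := by
    refine ((isCompact_closedBall (0 : ℂ) ρ).inter_left hS).image_of_continuousOn ?_
    rintro w ⟨hw, -⟩
    obtain ⟨z, hz, rfl⟩ := hSf hw
    exact (continuousAt_leftInvOn hU hf hg hz).continuousWithinAt
  have hsub : e ∉ Function.invFunOn f Kᶜ '' (S ∩ Metric.closedBall 0 ρ) := by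
    rintro ⟨w, ⟨hw, -⟩, rfl⟩
    obtain ⟨z, hz, rfl⟩ := hSf hw
    rw [hg hz] at he
    exact hz he
  filter_upwards [self_mem_nhdsWithin,
    nhdsWithin_le_nhds (hcomp.isClosed.isOpen_compl.mem_nhds hsub),
    nhdsWithin_le_nhds (Metric.ball_mem_nhds e one_pos)] with z hz hz1 hz2 hz3
  refine hz1 ⟨f z, ⟨hz3, ?_⟩, hg hz⟩
  rw [mem_closedBall_zero_iff]
  refine hρ z hz ?_
  have := norm_sub_norm_le z e
  rw [Metric.mem_ball, dist_eq_norm] at hz2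
  linarith

/-- The lower bound is automatic. For `b > M` the set `b ≤ u` is closed and inside the range of `f`,
so `f z` eventually leaves it. -/
theorem tendsto_of_image_eq_setOf_lt {K : Set ℂ} (hK : IsCompact K) {f : ℂ → ℂ} {c : ℂ}
    (hc : c ≠ 0) (hf : DifferentiableOn ℂ f Kᶜ) (hinj : InjOn f Kᶜ)
    (h : Tendsto (fun z => f z / z) (cobounded ℂ) (𝓝 c)) {u : ℂ → ℝ} (hu : Continuous u) {M : ℝ}
    (him : f '' Kᶜ = {w | M < u w}) {e : ℂ} (he : e ∈ K) :
    Tendsto (fun z => u (f z)) (𝓝[Kᶜ] e) (𝓝 M) := by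
  rw [tendsto_order]
  constructor
  · intro b hb
    filter_upwards [self_mem_nhdsWithin] with z hz
    have : f z ∈ {w | M < u w} := him ▸ mem_image_of_mem f hz
    exact hb.trans this
  · intro b hb
    filter_upwards [eventually_notMem_of_injOn hK hc hf hinj h (S := {w | b ≤ u w})
      (isClosed_le continuous_const hu) (fun w (hw : b ≤ u w) => him ▸ hb.trans_le hw) he] with z hz
    exact not_le.1 hz

theorem exists_mem_neBot_nhdsWithin_compl {K : Set ℂ} (hK : IsCompact K) (hne : K.Nonempty) :
    ∃ e ∈ K, (𝓝[Kᶜ] e).NeBot := by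
  have h1 : (frontier K).Nonempty := nonempty_frontier_iff.2 ⟨hne, hK.ne_univ⟩
  obtain ⟨e, he⟩ := h1
  rw [frontier_eq_closure_inter_closure, hK.isClosed.closure_eq] at he
  exact ⟨e, he.1, mem_closure_iff_nhdsWithin_neBot.1 he.2⟩

/-! ### The maximum principle on an exterior domain -/

/-- The maximum principle on the complement of a compact set, including infinity. -/
theorem norm_le_of_tendsto_boundary {K : Set ℂ} (hK : IsCompact K) (hne : K.Nonempty)
    (hconn : IsPreconnected Kᶜ) {q : ℂ → ℂ} (hq : DifferentiableOn ℂ q Kᶜ) {l : ℂ}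
    (hl : Tendsto q (cobounded ℂ) (𝓝 l)) {M : ℝ}
    (hM : ∀ e ∈ K, Tendsto (fun z => ‖q z‖) (𝓝[Kᶜ] e) (𝓝 M)) : ∀ z ∈ Kᶜ, ‖q z‖ ≤ M := by
  have hU := hK.isClosed.isOpen_compl
  -- An attained maximum makes `q` constant, and a frontier point of `K` then identifies `‖q z‖`
  -- with `M`.
  have key : ∀ z ∈ Kᶜ, IsMaxOn (norm ∘ q) Kᶜ z → ‖q z‖ ≤ M := by
    intro z hz hmax
    have hc := Complex.eqOn_of_isPreconnected_of_isMaxOn_norm hconn hU hq hz hmax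
    obtain ⟨e, he, hbot⟩ := exists_mem_neBot_nhdsWithin_compl hK hne
    have h1 : Tendsto (fun w => ‖q w‖) (𝓝[Kᶜ] e) (𝓝 ‖q z‖) := by
      refine tendsto_const_nhds.congr' ?_
      filter_upwards [self_mem_nhdsWithin] with w hw
      rw [hc hw, Function.const]
    exact (tendsto_nhds_unique h1 (hM e he)).le
  -- If `‖q z‖` exceeded both `‖l‖` and `M`, its superlevel set would be bounded and closed in `ℂ`,
  -- so a maximum would be attained.
  have hlarge : ∀ z ∈ Kᶜ, ‖l‖ < ‖q z‖ → ‖q z‖ ≤ M := by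
    intro z hz hlt
    by_contra! hMz
    set S : Set ℂ := {w | w ∈ Kᶜ ∧ ‖q z‖ ≤ ‖q w‖} with hS
    have hSc : IsClosed S := by
      rw [← isOpen_compl_iff, isOpen_iff_mem_nhds]
      intro w hw
      by_cases hwK : w ∈ K
      · filter_upwards [eventually_nhdsWithin_iff.1 ((hM w hwK).eventually (gt_mem_nhds hMz))]
          with x hx hxS
        exact not_le.2 (hx hxS.1) hxS.2
      · have hlt : ‖q w‖ < ‖q z‖ := not_le.1 fun h => hw ⟨hwK, h⟩
        filter_upwards [(hq.continuousOn.continuousAt (hU.mem_nhds hwK)).norm.eventually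
          (gt_mem_nhds hlt)] with x hx hxS
        exact not_le.2 hx hxS.2
    have hSb : IsBounded S := by
      rw [isBounded_def]
      filter_upwards [hl.norm.eventually (gt_mem_nhds hlt)] with x hx hxS
      exact not_le.2 hx hxS.2
    have hScomp : IsCompact S := Metric.isCompact_of_isClosed_isBounded hSc hSb
    obtain ⟨x, hx, hmax⟩ := hScomp.exists_isMaxOn ⟨z, hz, le_rfl⟩
      (f := fun w => ‖q w‖) (hq.continuousOn.norm.mono fun w hw => hw.1)
    refine absurd (key x hx.1 fun w hw => ?_) (not_le.2 (hMz.trans_le hx.2))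
    by_cases h : ‖q z‖ ≤ ‖q w‖
    · exact hmax ⟨hw, h⟩
    · exact (not_le.1 h).le.trans hx.2
  intro z hz
  by_contra! hMz
  -- The remaining case: the supremum is `‖l‖`, attained at infinity. In the coordinate `1 / z` this
  -- is a local maximum, so `q` equals `l` near infinity and `key` applies at a finite point.
  have hall : ∀ w ∈ Kᶜ, ‖q w‖ ≤ ‖l‖ := by
    intro w hw
    by_contra! hlt
    have hzl : ‖q z‖ ≤ ‖l‖ := by
      by_contra! h
      exact absurd (hlarge z hz h) (not_le.2 hMz)
    exact absurd (hlarge w hw hlt) (not_le.2 (hMz.trans_le (hzl.trans hlt.le)))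
  have hQ := analyticAt_update_inv (eventually_differentiableAt_cobounded hK hq) hl
  have hmax : IsLocalMax (norm ∘ Function.update (fun t => q t⁻¹) 0 l) 0 := by
    have h1 := tendsto_inv₀_nhdsNE_zero.eventually (eventually_mem_compl_cobounded hK)
    filter_upwards [eventually_nhdsWithin_iff.1 h1] with t ht
    rcases eq_or_ne t 0 with rfl | ht0
    · rfl
    · simpa [ht0] using hall _ (ht ht0)
  have hdiff : ∀ᶠ t in 𝓝 (0 : ℂ),
      DifferentiableAt ℂ (Function.update (fun t => q t⁻¹) 0 l) t :=
    hQ.eventually_analyticAt.mono fun t ht => ht.differentiableAt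
  have hev := (Complex.eventually_eq_of_isLocalMax_norm hdiff hmax).filter_mono
    (nhdsWithin_le_nhds (s := {0}ᶜ))
  obtain ⟨t, ⟨ht1, ht2⟩, ht3⟩ := ((hev.and (tendsto_inv₀_nhdsNE_zero.eventually
    (eventually_mem_compl_cobounded hK))).and self_mem_nhdsWithin).exists
  rw [Function.update_of_ne ht3, Function.update_self] at ht1
  have h2 := key t⁻¹ ht2 fun w hw => by simpa [ht1] using hall w hw
  rw [ht1] at h2
  exact absurd (hMz.trans_le (hall z hz)) (not_lt.2 h2)

/-- The maximum principle for `q` and for `1 / q` gives `‖q‖ = M` throughout, hence `q` is constant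
and equals its limit at infinity. -/
theorem eqOn_of_tendsto_norm_boundary {K : Set ℂ} (hK : IsCompact K) (hne : K.Nonempty)
    (hconn : IsPreconnected Kᶜ) {q : ℂ → ℂ} (hq : DifferentiableOn ℂ q Kᶜ)
    (hq0 : ∀ z ∈ Kᶜ, q z ≠ 0) {l : ℂ} (hl0 : l ≠ 0)
    (hl : Tendsto q (cobounded ℂ) (𝓝 l)) {M : ℝ} (hM0 : 0 < M)
    (hM : ∀ e ∈ K, Tendsto (fun z => ‖q z‖) (𝓝[Kᶜ] e) (𝓝 M)) : ∀ z ∈ Kᶜ, q z = l := by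
  have h1 := norm_le_of_tendsto_boundary hK hne hconn hq hl hM
  have h2 := norm_le_of_tendsto_boundary hK hne hconn (hq.inv hq0) (hl.inv₀ hl0) (M := M⁻¹)
    fun e he => by simpa using (hM e he).inv₀ hM0.ne'
  have h3 : ∀ z ∈ Kᶜ, ‖q z‖ = M := by
    intro z hz
    refine le_antisymm (h1 z hz) ?_
    have := h2 z hz
    rw [Pi.inv_apply, norm_inv] at this
    exact (inv_le_inv₀ (norm_pos_iff.2 (hq0 z hz)) hM0).1 this
  intro z hz
  have hc := Complex.eqOn_of_isPreconnected_of_isMaxOn_norm hconn hK.isClosed.isOpen_compl hq hz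
    fun w hw => by simp [h3 z hz, h3 w hw]
  refine tendsto_nhds_unique (tendsto_const_nhds.congr' ?_) hl
  filter_upwards [eventually_mem_compl_cobounded hK] with w hw
  rw [hc hw, Function.const]

/-! ### Cauchy transforms and polynomial parts at infinity -/

/-- The integral does not change when the radius grows; the integrand is then `O(r⁻²)` on a circle
of length `2πr`. -/
theorem circleIntegral_eq_zero_of_isBigO_inv {K : Set ℂ} (hK : IsCompact K) {f : ℂ → ℂ}
    (hf : DifferentiableOn ℂ f Kᶜ) (hO : f =O[cobounded ℂ] fun z => z⁻¹) {z : ℂ} {R : ℝ}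
    (hR : K ⊆ Metric.ball 0 R) (hz : z ∈ Metric.ball (0 : ℂ) R) :
    (∮ ζ in C(0, R), f ζ / (ζ - z)) = 0 := by
  have hR0 : 0 < R := Metric.nonempty_ball.1 ⟨z, hz⟩
  have hdiff : ∀ ζ ∉ Metric.ball (0 : ℂ) R, DifferentiableAt ℂ (fun ζ => f ζ / (ζ - z)) ζ := by
    intro ζ hζ
    have h1 : ζ ∈ Kᶜ := fun h => hζ (hR h)
    have h2 : ζ - z ≠ 0 := sub_ne_zero.2 fun h => hζ (h ▸ hz)
    have h3 := hf.differentiableAt (hK.isClosed.isOpen_compl.mem_nhds h1)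
    fun_prop (disch := assumption)
  have heq : ∀ r, R ≤ r → (∮ ζ in C(0, r), f ζ / (ζ - z)) = ∮ ζ in C(0, R), f ζ / (ζ - z) := by
    intro r hr
    refine Complex.circleIntegral_eq_of_differentiable_on_annulus_off_countable hR0 hr
      countable_empty (fun ζ hζ => (hdiff ζ hζ.2).continuousAt.continuousWithinAt) fun ζ hζ => ?_
    exact hdiff ζ fun h => hζ.1.2 (Metric.ball_subset_closedBall h)
  obtain ⟨A, hA, hO⟩ := hO.exists_pos
  rw [Asymptotics.isBigOWith_iff] at hO
  have hO' : ∃ r₀, ∀ ζ : ℂ, r₀ ≤ ‖ζ‖ → ‖f ζ‖ ≤ A * ‖ζ⁻¹‖ := by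
    obtain ⟨r₀, -, h⟩ := (hasBasis_cobounded_norm (E := ℂ)).eventually_iff.1 hO
    exact ⟨r₀, fun ζ hζ => h hζ⟩
  obtain ⟨r₀, hr₀⟩ := hO'
  have hbound : ∀ᶠ r : ℝ in atTop,
      ‖∮ ζ in C(0, R), f ζ / (ζ - z)‖ ≤ 2 * Real.pi * A * (r - ‖z‖)⁻¹ := by
    filter_upwards [eventually_ge_atTop R, eventually_ge_atTop r₀, eventually_gt_atTop ‖z‖,
      eventually_gt_atTop 0] with r h1 h2 h3 h4
    rw [← heq r h1]
    refine (circleIntegral.norm_integral_le_of_norm_le_const h4.le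
      (C := A * r⁻¹ * (r - ‖z‖)⁻¹) fun ζ hζ => ?_).trans (le_of_eq ?_)
    · rw [mem_sphere_zero_iff_norm] at hζ
      rw [div_eq_mul_inv, norm_mul]
      have h5 := hr₀ ζ (hζ ▸ h2)
      rw [norm_inv, hζ] at h5
      refine mul_le_mul h5 ?_ (norm_nonneg _) (by positivity)
      rw [norm_inv]
      have h6 := norm_sub_norm_le ζ z
      rw [hζ] at h6
      exact inv_anti₀ (by linarith) h6
    · field_simp
  have hlim : Tendsto (fun r : ℝ => 2 * Real.pi * A * (r - ‖z‖)⁻¹) atTop (𝓝 0) := by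
    have h1 : Tendsto (fun r : ℝ => r - ‖z‖) atTop atTop := by
      simpa [sub_eq_add_neg] using tendsto_atTop_add_const_right atTop (-‖z‖) tendsto_id
    simpa using (tendsto_inv_atTop_zero.comp h1).const_mul (2 * Real.pi * A)
  exact norm_le_zero_iff.1 (ge_of_tendsto hlim hbound)

/-- The Cauchy transform of a function which agrees with a polynomial up to `O(1 / z)` at infinity
is that polynomial. -/
theorem circleIntegral_eq_eval_of_isBigO {K : Set ℂ} (hK : IsCompact K) {f : ℂ → ℂ}
    (hf : DifferentiableOn ℂ f Kᶜ) {F : ℂ[X]}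
    (hO : (fun z => f z - F.eval z) =O[cobounded ℂ] fun z => z⁻¹) {z : ℂ} {R : ℝ}
    (hR : K ⊆ Metric.ball 0 R) (hz : z ∈ Metric.ball (0 : ℂ) R) :
    (2 * (Real.pi : ℂ) * Complex.I)⁻¹ * (∮ ζ in C(0, R), f ζ / (ζ - z)) = F.eval z := by
  have hR0 : 0 < R := Metric.nonempty_ball.1 ⟨z, hz⟩
  have h0 := circleIntegral_eq_zero_of_isBigO_inv hK
    (hf.sub F.differentiable.differentiableOn) hO hR hz
  have hne : ∀ ζ ∈ Metric.sphere (0 : ℂ) R, ζ - z ≠ 0 := by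
    intro ζ hζ h
    rw [sub_eq_zero] at h
    subst h
    rw [mem_sphere_zero_iff_norm] at hζ
    rw [mem_ball_zero_iff, hζ] at hz
    exact lt_irrefl _ hz
  have hK' : ∀ ζ ∈ Metric.sphere (0 : ℂ) R, ζ ∈ Kᶜ := by
    intro ζ hζ h
    have := hR h
    rw [mem_sphere_zero_iff_norm] at hζ
    rw [mem_ball_zero_iff, hζ] at this
    exact lt_irrefl _ this
  have hi1 : CircleIntegrable (fun ζ => f ζ / (ζ - z)) 0 R :=
    ContinuousOn.circleIntegrable hR0.le
      ((hf.continuousOn.mono hK').div (by fun_prop) hne)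
  have hi2 : CircleIntegrable (fun ζ => F.eval ζ / (ζ - z)) 0 R :=
    ContinuousOn.circleIntegrable hR0.le (F.continuous.continuousOn.div (by fun_prop) hne)
  have hC := Complex.circleIntegral_div_sub_of_differentiable_on_off_countable (c := 0) (R := R)
    countable_empty hz F.continuous.continuousOn fun x _ => F.differentiable x
  have hsub : (∮ ζ in C(0, R), f ζ / (ζ - z)) = ∮ ζ in C(0, R), F.eval ζ / (ζ - z) := by
    rw [← sub_eq_zero, ← circleIntegral.integral_sub hi1 hi2]
    refine Eq.trans ?_ h0
    exact circleIntegral.integral_congr hR0.le fun ζ _ => (sub_div (f ζ) (F.eval ζ) (ζ - z)).symm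
  rw [hsub, hC, inv_mul_cancel_left₀]
  exact Complex.two_pi_I_ne_zero

/-- The polynomial part at infinity of a function with a pole there. -/
theorem exists_polynomial_isBigO {K : Set ℂ} (hK : IsCompact K) {f : ℂ → ℂ}
    (hf : DifferentiableOn ℂ f Kᶜ) {k : ℕ} {c : ℂ}
    (hc : Tendsto (fun z => f z / z ^ k) (cobounded ℂ) (𝓝 c)) :
    ∃ F : ℂ[X], (fun z => f z - F.eval z) =O[cobounded ℂ] fun z => z⁻¹ := by
  have hd : ∀ᶠ z in cobounded ℂ, DifferentiableAt ℂ (fun z => f z / z ^ k) z := by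
    filter_upwards [eventually_differentiableAt_cobounded hK hf,
      eventually_ne_cobounded (0 : ℂ)] with z hz hz0
    exact hz.div (by fun_prop) (pow_ne_zero k hz0)
  obtain ⟨p, hp⟩ := analyticAt_update_inv hd hc
  have hO := hp.isBigO_sub_partialSum_pow (k + 1)
  -- With `p` the expansion of `f z / z ^ k` in `t = 1 / z`, the terms `i ≤ k` give `z ^ (k - i)`,
  -- and the remainder `O(t ^ (k + 1))` times `z ^ k` is `O(1 / z)`.
  refine ⟨∑ i ∈ Finset.range (k + 1), Polynomial.C (p.coeff i) * X ^ (k - i), ?_⟩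
  have hO : (fun t => Function.update (fun t => f t⁻¹ / t⁻¹ ^ k) 0 c (0 + t)
      - p.partialSum (k + 1) t) =O[𝓝 0] fun t => t ^ (k + 1) := by
    refine hO.trans (Asymptotics.IsBigO.of_norm_right ?_)
    simpa only [norm_pow] using Asymptotics.isBigO_refl _ _
  have h1 := (Asymptotics.isBigO_refl (fun z : ℂ => z ^ k) (cobounded ℂ)).mul
    (hO.comp_tendsto tendsto_inv₀_cobounded)
  refine h1.congr' ?_ ?_
  · filter_upwards [eventually_ne_cobounded (0 : ℂ)] with z hz
    have hz' := inv_ne_zero hz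
    simp only [Function.comp_apply, zero_add, Function.update_of_ne hz', inv_inv, mul_sub,
      FormalMultilinearSeries.partialSum, FormalMultilinearSeries.apply_eq_pow_smul_coeff,
      eval_finsetSum, eval_mul, eval_C, eval_pow, eval_X, Finset.mul_sum, smul_eq_mul]
    congr 1
    · field_simp
    · refine Finset.sum_congr rfl fun i hi => ?_
      have hik : i ≤ k := Nat.lt_succ_iff.1 (Finset.mem_range.1 hi)
      rw [inv_pow, pow_sub₀ z hz hik]
      ring
  · filter_upwards [eventually_ne_cobounded (0 : ℂ)] with z hz
    rw [Function.comp_apply, inv_pow, pow_succ, mul_inv, mul_inv_cancel_left₀ (pow_ne_zero k hz)]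

/-! ### Topology of the preimage of `Ω` -/

/-- Complements of parts `K` of the preimage of `Ω` under a polynomial are connected if the rest of
the preimage and one full fibre outside `Ω` lie in a connected set which avoids `K`. -/
theorem isPreconnected_compl_of_subset_preimage {P : ℂ[X]} (hP : 0 < P.degree) {Ω K T : Set ℂ}
    (hΩ : IsClosed Ω) (hconn : IsPreconnected Ωᶜ) (hK : IsClosed K)
    (hKΩ : ∀ z ∈ K, P.eval z ∈ Ω) (hT : IsPreconnected T) (hTK : T ⊆ Kᶜ)
    (hrest : ∀ z ∉ K, P.eval z ∈ Ω → z ∈ T) {y : ℂ} (hy : y ∉ Ω)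
    (hfib : ∀ z, P.eval z = y → z ∈ T) : IsPreconnected Kᶜ := by
  have hopen : IsOpenMap P.eval :=
    (P.isOpenQuotientMap_eval (natDegree_pos_iff_degree_pos.2 hP).ne').isOpenMap
  have hclosed : IsClosedMap P.eval := by
    refine (isProperMap_iff_tendsto_cocompact.2 ⟨P.continuous, ?_⟩).isClosedMap
    rw [← Metric.cobounded_eq_cocompact, ← tendsto_norm_atTop_iff_cobounded]
    exact P.tendsto_norm_atTop hP tendsto_norm_cobounded_atTop
  -- The part `V` of `v` off `K` avoids `T`, so `P` maps it off `Ω`. Its closure adds only points of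
  -- `K`, which go into `Ω`; hence `P '' V` is open and also relatively closed in `Ωᶜ`. It omits
  -- `y`, so by connectedness it is empty.
  have key : ∀ u v : Set ℂ, IsOpen u → IsOpen v → Kᶜ ⊆ u ∪ v → Kᶜ ∩ (u ∩ v) = ∅ → T ⊆ u →
      Kᶜ ⊆ u := by
    intro u v hu hv huv hdisj hTu
    set V := v ∩ Kᶜ with hV
    have hVT : ∀ z ∈ V, z ∉ T := fun z hz hzT => by
      have : z ∈ Kᶜ ∩ (u ∩ v) := ⟨hz.2, hTu hzT, hz.1⟩
      rwa [hdisj] at this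
    have hVΩ : ∀ z ∈ V, P.eval z ∉ Ω := fun z hz h => hVT z hz (hrest z hz.2 h)
    have hcl : closure V ⊆ V ∪ K := by
      intro z hz
      by_cases hzK : z ∈ K
      · exact Or.inr hzK
      · refine Or.inl ((huv hzK).elim (fun hzu => ?_) fun hzv => ⟨hzv, hzK⟩)
        obtain ⟨x, hx, hxV⟩ := mem_closure_iff.1 hz u hu hzu
        have : x ∈ Kᶜ ∩ (u ∩ v) := ⟨hxV.2, hx, hxV.1⟩
        rw [hdisj] at this
        exact this.elim
    have hC : IsClosed (Ω ∪ P.eval '' closure V) := hΩ.union (hclosed _ isClosed_closure)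
    have hCV : Ω ∪ P.eval '' closure V ⊆ Ω ∪ P.eval '' V := by
      rintro w (hw | ⟨z, hz, rfl⟩)
      · exact Or.inl hw
      · exact (hcl hz).elim (fun h => Or.inr ⟨z, h, rfl⟩) fun h => Or.inl (hKΩ z h)
    have hpre := isPreconnected_iff_subset_of_disjoint.1 hconn (P.eval '' V)
      (Ω ∪ P.eval '' closure V)ᶜ (hopen _ (hv.inter hK.isOpen_compl)) hC.isOpen_compl ?_ ?_
    · rcases hpre with h | h
      · obtain ⟨z, hz, hzy⟩ := h hy
        exact (hVT z hz (hfib z hzy)).elim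
      · intro z hz
        refine (huv hz).elim id fun hzv => ?_
        exact (h (hVΩ z ⟨hzv, hz⟩) (Or.inr ⟨z, subset_closure ⟨hzv, hz⟩, rfl⟩)).elim
    · intro w hw
      by_cases h : w ∈ P.eval '' V
      · exact Or.inl h
      · exact Or.inr fun h' => (hCV h').elim hw h
    · rw [eq_empty_iff_forall_notMem]
      rintro w ⟨-, ⟨z, hz, rfl⟩, h⟩
      exact h (Or.inr ⟨z, subset_closure hz, rfl⟩)
  rw [isPreconnected_iff_subset_of_disjoint]
  intro u v hu hv huv hdisj
  rcases isPreconnected_iff_subset_of_disjoint.1 hT u v hu hv (hTK.trans huv)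
    (subset_empty_iff.1 (hdisj ▸ inter_subset_inter_left _ hTK)) with h | h
  · exact Or.inl (key u v hu hv huv hdisj h)
  · exact Or.inr (key v u hv hu (union_comm u v ▸ huv) (inter_comm u v ▸ hdisj) h)

theorem degree_C_mul_X_pow_add_C_pos {n : ℕ} (hn : 0 < n) {α α₀ : ℝ} (hα : 0 < α) {P : ℂ[X]}
    (hP : P = C (α : ℂ) * X ^ n + C (α₀ : ℂ)) : 0 < P.degree := by
  rw [hP, degree_add_C] <;> rw [degree_C_mul_X_pow n (Complex.ofReal_ne_zero.2 hα.ne')] <;>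
    exact_mod_cast hn

section RootBranch

variable {Ω : Set ℂ} {n : ℕ} {α α₀ : ℝ} {P : ℂ[X]}

/-- The principal branch of the inverse of `α * z ^ n + α₀`. -/
noncomputable def rootBranch (n : ℕ) (α α₀ : ℝ) (y : ℂ) : ℂ :=
  Complex.exp (Complex.log ((y - α₀) / α) / n)

theorem rootBranch_ne_zero (y : ℂ) : rootBranch n α α₀ y ≠ 0 := Complex.exp_ne_zero _

theorem sub_div_mem_slitPlane (hα : 0 < α) (hα₀ : ∀ x : ℝ, (x : ℂ) ∈ Ω → α₀ < x) {y : ℂ}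
    (hy : y ∈ Ω) : (y - α₀) / α ∈ Complex.slitPlane := by
  have hre : ((y - α₀) / α).re = (y.re - α₀) / α := by
    rw [Complex.div_ofReal_re]; simp
  have him : ((y - α₀) / α).im = y.im / α := by
    rw [Complex.div_ofReal_im]; simp
  rw [Complex.mem_slitPlane_iff, hre, him]
  by_cases h : y.im = 0
  · left
    have hy' : ((y.re : ℝ) : ℂ) = y := Complex.ext (by simp) (by simp [h])
    have := hα₀ y.re (hy' ▸ hy)
    exact div_pos (by linarith) hα
  · exact Or.inr (div_ne_zero h hα.ne')

theorem eval_rootBranch (hn : 0 < n) (hα : 0 < α) (hP : P = C (α : ℂ) * X ^ n + C (α₀ : ℂ))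
    {y : ℂ} (hy : y ≠ α₀) : P.eval (rootBranch n α α₀ y) = y := by
  have hα' : (α : ℂ) ≠ 0 := Complex.ofReal_ne_zero.2 hα.ne'
  have hn' : (n : ℂ) ≠ 0 := Nat.cast_ne_zero.2 hn.ne'
  rw [hP, rootBranch]
  simp only [eval_add, eval_mul, eval_C, eval_pow, eval_X]
  rw [← Complex.exp_nat_mul, mul_div_cancel₀ _ hn',
    Complex.exp_log (div_ne_zero (sub_ne_zero.2 hy) hα'), mul_div_cancel₀ _ hα', sub_add_cancel]

theorem continuousOn_rootBranch (hα : 0 < α) (hα₀ : ∀ x : ℝ, (x : ℂ) ∈ Ω → α₀ < x) :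
    ContinuousOn (rootBranch n α α₀) Ω := by
  refine Complex.continuous_exp.comp_continuousOn (ContinuousOn.div_const ?_ _)
  exact ContinuousOn.clog (by fun_prop) fun y hy => sub_div_mem_slitPlane hα hα₀ hy

/-- The open sector around the positive real axis with opening angle `2 * π / n`. -/
def rootSector (n : ℕ) : Set ℂ := {z | z ≠ 0 ∧ |n * z.arg| < Real.pi}

theorem rootBranch_mem_rootSector (hn : 0 < n) {y : ℂ}
    (hy : (y - α₀) / α ∈ Complex.slitPlane) : rootBranch n α α₀ y ∈ rootSector n := by
  refine ⟨rootBranch_ne_zero y, ?_⟩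
  set w := (y - α₀) / α
  have hn1 : (1 : ℝ) ≤ n := by exact_mod_cast hn
  have him : (Complex.log w / n).im = w.arg / n := by
    rw [← Complex.ofReal_natCast, Complex.div_ofReal_im, Complex.log_im]
  have harg : |w.arg| < Real.pi := by
    have h1 := (Complex.mem_slitPlane_iff_arg.1 hy).1
    exact abs_lt.2 ⟨Complex.neg_pi_lt_arg w, lt_of_le_of_ne (Complex.arg_le_pi w) h1⟩
  have hle : |w.arg / n| < Real.pi := by
    rw [abs_div, Nat.abs_cast]
    exact (div_le_self (abs_nonneg _) hn1).trans_lt harg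
  have hlog : (rootBranch n α α₀ y).arg = w.arg / n := by
    rw [← Complex.log_im, rootBranch, Complex.log_exp, him]
    · rw [him]; exact (abs_lt.1 hle).1
    · rw [him]; exact (abs_lt.1 hle).2.le
  rw [hlog, mul_div_cancel₀ _ (by positivity)]
  exact harg

theorem rootBranch_eval (hn : 0 < n) (hα : 0 < α) (hP : P = C (α : ℂ) * X ^ n + C (α₀ : ℂ))
    {z : ℂ} (hz : z ∈ rootSector n) : rootBranch n α α₀ (P.eval z) = z := by
  have hα' : (α : ℂ) ≠ 0 := Complex.ofReal_ne_zero.2 hα.ne'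
  have hn' : (n : ℂ) ≠ 0 := Nat.cast_ne_zero.2 hn.ne'
  have h1 : (P.eval z - α₀) / α = Complex.exp (n * Complex.log z) := by
    rw [Complex.exp_nat_mul, Complex.exp_log hz.1, hP]
    simp [hα']
  have him : (n * Complex.log z).im = n * z.arg := by
    rw [← Complex.ofReal_natCast, Complex.im_ofReal_mul, Complex.log_im]
  have h2 := abs_lt.1 hz.2
  rw [rootBranch, h1, Complex.log_exp (him ▸ h2.1) (him ▸ h2.2.le), mul_div_cancel_left₀ _ hn',
    Complex.exp_log hz.1]

/-- The complement of a sector is star-shaped about its apex. -/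
theorem isPreconnected_setOf_mul_notMem_rootSector (n : ℕ) (b : ℂ) :
    IsPreconnected {z | b * z ∉ rootSector n} := by
  have h0 : (0 : ℂ) ∈ {z | b * z ∉ rootSector n} := fun h => h.1 (mul_zero b)
  refine (StarConvex.isPathConnected (a := (0 : ℂ)) ?_ h0).isConnected.isPreconnected
  rw [starConvex_zero_iff]
  intro z hz t ht0 ht1
  rcases ht0.eq_or_lt with rfl | ht
  · simpa using h0
  · intro h
    refine hz ⟨fun h' => h.1 ?_, ?_⟩
    · rw [mul_smul_comm, h', smul_zero]
    · have := h.2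
      rwa [mul_smul_comm, Complex.real_smul, Complex.arg_real_mul _ ht] at this

/-- The components are the rotations of the principal branch by powers of a primitive `n`-th root of
unity, each in its own open sector. The rest of the preimage, and the fibre `{0}` over `α₀`, lie in
the connected complement of that sector. -/
theorem exists_components_preimage (hΩ : IsSimplyConnectedCompact Ω)
    (hΩ_nontrivial : Ω.Nontrivial) (hn : 0 < n) (hα : 0 < α)
    (hα₀ : ∀ x : ℝ, (x : ℂ) ∈ Ω → α₀ < x) (hP : P = C (α : ℂ) * X ^ n + C (α₀ : ℂ)) :
    ∃ K : Fin n → Set ℂ, (∀ j, IsSimplyConnectedCompact (K j)) ∧ (∀ j, (K j).Nontrivial) ∧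
      Pairwise (fun i j => Disjoint (K i) (K j)) ∧ {z | P.eval z ∈ Ω} = ⋃ j, K j := by
  have hω := Complex.isPrimitiveRoot_exp n hn.ne'
  set ω := Complex.exp (2 * Real.pi * Complex.I / n)
  have hω0 : ∀ j : ℕ, ω ^ j ≠ 0 := fun j => pow_ne_zero j (Complex.exp_ne_zero _)
  have hα₀Ω : (α₀ : ℂ) ∉ Ω := fun h => lt_irrefl _ (hα₀ α₀ h)
  have hrot : ∀ (j : ℕ) (z : ℂ), P.eval (ω ^ j * z) = P.eval z := by
    intro j z
    rw [hP]
    simp only [eval_add, eval_mul, eval_C, eval_pow, eval_X]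
    rw [mul_pow, ← pow_mul, mul_comm j n, pow_mul, hω.pow_eq_one, one_pow, one_mul]
  have hev : ∀ y ∈ Ω, P.eval (rootBranch n α α₀ y) = y := fun y hy =>
    eval_rootBranch hn hα hP fun h => hα₀Ω (h ▸ hy)
  set K : Fin n → Set ℂ := fun j => (fun y => ω ^ (j : ℕ) * rootBranch n α α₀ y) '' Ω with hK
  have hKΩ : ∀ j, ∀ z ∈ K j, P.eval z ∈ Ω := by
    rintro j _ ⟨y, hy, rfl⟩
    simpa only [hrot, hev y hy] using hy
  have hinj : ∀ j : Fin n, InjOn (fun y => ω ^ (j : ℕ) * rootBranch n α α₀ y) Ω := by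
    intro j y hy y' hy' h
    have := congrArg P.eval h
    simpa only [hrot, hev y hy, hev y' hy'] using this
  have hcont : ∀ j : Fin n, ContinuousOn (fun y => ω ^ (j : ℕ) * rootBranch n α α₀ y) Ω :=
    fun j => continuousOn_const.mul (continuousOn_rootBranch hα hα₀)
  refine ⟨K, fun j => ⟨hΩ.isCompact.image_of_continuousOn (hcont j),
    hΩ.isConnected.image _ (hcont j), ?_⟩, fun j => hΩ_nontrivial.image_of_injOn (hinj j), ?_, ?_⟩
  · have hcompact : IsCompact (K j) := hΩ.isCompact.image_of_continuousOn (hcont j)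
    refine ⟨nonempty_compl.2 hcompact.ne_univ, ?_⟩
    refine isPreconnected_compl_of_subset_preimage (degree_C_mul_X_pow_add_C_pos hn hα hP)
      hΩ.isCompact.isClosed hΩ.isConnected_compl.isPreconnected hcompact.isClosed (hKΩ j)
      (isPreconnected_setOf_mul_notMem_rootSector n (ω ^ (j : ℕ))⁻¹) ?_ ?_ hα₀Ω ?_
    · rintro _ hz ⟨y, hy, rfl⟩
      refine hz ?_
      rw [inv_mul_cancel_left₀ (hω0 j)]
      exact rootBranch_mem_rootSector hn (sub_div_mem_slitPlane hα hα₀ hy)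
    · intro z hzK hzΩ hz
      refine hzK ⟨P.eval z, hzΩ, ?_⟩
      have h1 : P.eval z = P.eval ((ω ^ (j : ℕ))⁻¹ * z) := by
        rw [← hrot j ((ω ^ (j : ℕ))⁻¹ * z), mul_inv_cancel_left₀ (hω0 j)]
      simp only
      rw [h1, rootBranch_eval hn hα hP hz, mul_inv_cancel_left₀ (hω0 j)]
    · intro z hz h
      refine h.1 ?_
      have : z = 0 := by
        rw [hP] at hz
        simpa [hα.ne', hn.ne'] using hz
      rw [this, mul_zero]
  · intro i j hij
    rw [disjoint_left]
    rintro _ ⟨y, hy, rfl⟩ ⟨y', hy', h⟩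
    have h1 := congrArg P.eval h
    simp only [hrot, hev y hy, hev y' hy'] at h1
    subst h1
    have h2 := mul_right_cancel₀ (rootBranch_ne_zero y') h
    exact hij (Fin.ext (hω.pow_inj j.2 i.2 h2)).symm
  · ext z
    rw [mem_iUnion]
    constructor
    · intro hz
      have h0 := rootBranch_ne_zero (n := n) (α := α) (α₀ := α₀) (P.eval z)
      have hpow : (z / rootBranch n α α₀ (P.eval z)) ^ n = 1 := by
        rw [div_pow, div_eq_one_iff_eq (pow_ne_zero n h0)]
        have h1 := hev _ hz
        generalize rootBranch n α α₀ (P.eval z) = x at h1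
        rw [hP] at h1
        simp only [eval_add, eval_mul, eval_C, eval_pow, eval_X, add_left_inj] at h1
        exact (mul_left_cancel₀ (Complex.ofReal_ne_zero.2 hα.ne') h1).symm
      have : NeZero n := ⟨hn.ne'⟩
      obtain ⟨i, hi, hiz⟩ := hω.eq_pow_of_pow_eq_one hpow
      exact ⟨⟨i, hi⟩, P.eval z, hz, by simp only [hiz, div_mul_cancel₀ _ h0]⟩
    · rintro ⟨j, hj⟩
      exact hKΩ j z hj

/-- All sheets of `P` meet at the critical point `0`, the only point over `α₀ ∉ Ω`; this makes `T =
{0}` admissible in the general criterion. -/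
theorem isPreconnected_compl_preimage (hΩ : IsSimplyConnectedCompact Ω) (hn : 0 < n) (hα : 0 < α)
    (hα₀ : (α₀ : ℂ) ∉ Ω) (hP : P = C (α : ℂ) * X ^ n + C (α₀ : ℂ)) :
    IsPreconnected {z | P.eval z ∈ Ω}ᶜ := by
  refine isPreconnected_compl_of_subset_preimage (degree_C_mul_X_pow_add_C_pos hn hα hP)
    hΩ.isCompact.isClosed hΩ.isConnected_compl.isPreconnected
    (hΩ.isCompact.isClosed.preimage P.continuous) (fun z hz => hz)
    (isPreconnected_singleton (x := (0 : ℂ))) ?_ (fun z hz h => (hz h).elim) hα₀ ?_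
  · rintro _ rfl h
    refine hα₀ ?_
    rw [mem_ofPred_eq, hP] at h
    simpa [hn.ne'] using h
  · intro z hz
    rw [hP] at hz
    simpa [hα.ne', hn.ne'] using hz

theorem isCompact_preimage_eval (hΩ : IsCompact Ω) (hP : 0 < P.degree) :
    IsCompact {z | P.eval z ∈ Ω} := by
  refine Metric.isCompact_of_isClosed_isBounded (hΩ.isClosed.preimage P.continuous) ?_
  have h : Tendsto P.eval (cobounded ℂ) (cobounded ℂ) := by
    rw [← tendsto_norm_atTop_iff_cobounded]
    exact P.tendsto_norm_atTop hP tendsto_norm_cobounded_atTop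
  rw [isBounded_def]
  exact h hΩ.isBounded

end RootBranch

/-! ### Roots of the slope of the exterior mapping -/

theorem isBigO_inv_of_tendsto_div {f : ℂ → ℂ} {c : ℂ} {k : ℕ} (hc : c ≠ 0)
    (h : Tendsto (fun z => f z / z ^ k) (cobounded ℂ) (𝓝 c)) :
    (fun z => (f z)⁻¹) =O[cobounded ℂ] fun z => (z ^ k)⁻¹ := by
  refine Asymptotics.isBigO_of_div_tendsto_nhds ?_ c⁻¹ ((h.inv₀ hc).congr fun z => ?_)
  · filter_upwards [eventually_ne_cobounded (0 : ℂ)] with z hz h0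
    exact (inv_ne_zero (pow_ne_zero k hz) h0).elim
  · simp only [Pi.div_apply]
    rw [inv_div, div_inv_eq_mul, div_eq_mul_inv, mul_comm]

/-- On a disc `h' / h` has a primitive `L`; normalised by `L 0 = 0` it is a logarithm of `h`, and
`exp (L / n)` is the root. -/
theorem exists_pow_eq_on_ball {h : ℂ → ℂ} {r : ℝ} (hr : 0 < r)
    (hd : DifferentiableOn ℂ h (Metric.ball 0 r)) (h0 : ∀ t ∈ Metric.ball (0 : ℂ) r, h t ≠ 0)
    (h1 : h 0 = 1) {n : ℕ} (hn : n ≠ 0) :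
    ∃ H : ℂ → ℂ, DifferentiableOn ℂ H (Metric.ball 0 r) ∧ H 0 = 1 ∧
      ∀ t ∈ Metric.ball (0 : ℂ) r, H t ^ n = h t := by
  have hball : IsOpen (Metric.ball (0 : ℂ) r) := Metric.isOpen_ball
  have hmem : (0 : ℂ) ∈ Metric.ball (0 : ℂ) r := Metric.mem_ball_self hr
  obtain ⟨L, hL0, hL⟩ := ((hd.deriv hball).div hd h0).isExactOn_ball.with_val_at 0 0
  have hexp : ∀ t ∈ Metric.ball (0 : ℂ) r, Complex.exp (L t) = h t := by
    intro t ht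
    have hder : ∀ s ∈ Metric.ball (0 : ℂ) r,
        HasDerivAt (fun s => Complex.exp (-L s) * h s) 0 s := by
      intro s hs
      have := (hL s hs).neg.cexp.mul (hd.differentiableAt (hball.mem_nhds hs)).hasDerivAt
      refine this.congr_deriv ?_
      have := h0 s hs
      simp only [Pi.div_apply, Pi.neg_apply]
      field_simp
      ring
    have hconst := (convex_ball (0 : ℂ) r).is_const_of_fderivWithin_eq_zero (𝕜 := ℂ)
      (fun s hs => (hder s hs).differentiableAt.differentiableWithinAt) (fun s hs => by
        rw [fderivWithin_of_isOpen hball hs]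
        ext
        simpa using (hder s hs).deriv) ht hmem
    rw [hL0, h1, neg_zero, Complex.exp_zero, mul_one, Complex.exp_neg] at hconst
    exact ((inv_mul_eq_one₀ (Complex.exp_ne_zero _)).1 hconst)
  refine ⟨fun t => Complex.exp (L t / n), fun t ht => ?_, by simp [hL0], fun t ht => ?_⟩
  · exact ((hL t ht).differentiableAt.div_const _).cexp.differentiableWithinAt
  · rw [← Complex.exp_nat_mul, mul_div_cancel₀ _ (Nat.cast_ne_zero.2 hn), hexp t ht]

namespace IsExteriorRiemannMap

variable {Ω : Set ℂ} {φ : ℂ → ℂ} {c : ℝ}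

theorem ofReal_ne_zero (hφ : IsExteriorRiemannMap Ω φ c) : (c : ℂ) ≠ 0 :=
  Complex.ofReal_ne_zero.2 hφ.pos.ne'

theorem tendsto_cobounded (hφ : IsExteriorRiemannMap Ω φ c) :
    Tendsto φ (cobounded ℂ) (cobounded ℂ) :=
  tendsto_cobounded_of_tendsto_div hφ.ofReal_ne_zero hφ.tendsto_div

theorem tendsto_invFunOn (hΩ : IsCompact Ω) (hφ : IsExteriorRiemannMap Ω φ c) :
    Tendsto (Function.invFunOn φ Ωᶜ) (cobounded ℂ) (cobounded ℂ) := by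
  rw [← tendsto_norm_atTop_iff_cobounded, tendsto_atTop]
  intro r
  obtain ⟨ρ, hρ⟩ := exists_norm_le_of_injOn hΩ hφ.ofReal_ne_zero hφ.differentiableOn
    hφ.bijOn.injOn hφ.tendsto_div r
  filter_upwards [tendsto_norm_cobounded_atTop.eventually (eventually_gt_atTop ρ),
    tendsto_norm_cobounded_atTop.eventually (eventually_gt_atTop 1)] with w hw hw1
  by_contra! hlt
  have hwim : w ∈ φ '' Ωᶜ := by rw [hφ.bijOn.image_eq]; exact hw1
  have := hρ _ (Function.invFunOn_mem hwim) hlt.le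
  rw [Function.invFunOn_eq hwim] at this
  exact absurd hw (not_lt.2 this)

/-- The difference quotients of an exterior Riemann mapping have holomorphic `n`-th roots. -/
theorem exists_root_slope (hΩ : IsCompact Ω) (hφ : IsExteriorRiemannMap Ω φ c) {y₀ : ℂ}
    (hy₀ : y₀ ∈ Ωᶜ) {n : ℕ} (hn : n ≠ 0) :
    ∃ g : ℂ → ℂ, DifferentiableOn ℂ g Ωᶜ ∧ (∀ y ∈ Ωᶜ, g y ≠ 0) ∧
      (∀ y ∈ Ωᶜ, c * (y - y₀) * g y ^ n = φ y - φ y₀) ∧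
      (fun y => g y - 1) =O[cobounded ℂ] fun y => y⁻¹ := by
  have hU := hΩ.isClosed.isOpen_compl
  have hc := hφ.ofReal_ne_zero
  set ψ := Function.invFunOn φ Ωᶜ with hψ
  have hψφ : LeftInvOn ψ φ Ωᶜ := hφ.bijOn.injOn.leftInvOn_invFunOn
  -- The slope normalised to tend to `1` at infinity. It has no zeros: off `y₀` by injectivity, at
  -- `y₀` because a univalent function has nonzero derivative.
  set G : ℂ → ℂ := fun y => dslope φ y₀ y / c with hG
  have hGd : DifferentiableOn ℂ G Ωᶜ :=
    ((Complex.differentiableOn_dslope (hU.mem_nhds hy₀)).2 hφ.differentiableOn).div_const _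
  have hGmul : ∀ y, c * (y - y₀) * G y = φ y - φ y₀ := by
    intro y
    rw [hG, mul_right_comm, mul_div_cancel₀ _ hc, mul_comm, ← smul_eq_mul, sub_smul_dslope]
  have hG0 : ∀ y ∈ Ωᶜ, G y ≠ 0 := by
    intro y hy h
    rcases eq_or_ne y y₀ with rfl | hne
    · rw [hG] at h
      simp only [dslope_same, div_eq_zero_iff, hc, or_false] at h
      exact deriv_ne_zero_of_injOn hU hφ.differentiableOn hφ.bijOn.injOn hy h
    · have := hGmul y
      rw [h, mul_zero, eq_comm, sub_eq_zero] at this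
      exact hne (hφ.bijOn.injOn hy hy₀ this)
  have hGlim : Tendsto G (cobounded ℂ) (𝓝 1) := by
    have h1 : Tendsto (fun y : ℂ => (φ y / y - φ y₀ * y⁻¹) / (c * (1 - y₀ * y⁻¹)))
        (cobounded ℂ) (𝓝 ((c - φ y₀ * 0) / (c * (1 - y₀ * 0)))) :=
      (hφ.tendsto_div.sub (tendsto_inv₀_cobounded.const_mul _)).div
        ((tendsto_const_nhds.sub (tendsto_inv₀_cobounded.const_mul _)).const_mul _) (by simpa using hc)
    have h2 : ((c : ℂ) - φ y₀ * 0) / (c * (1 - y₀ * 0)) = 1 := by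
      rw [mul_zero, mul_zero, sub_zero, sub_zero, mul_one, div_self hc]
    rw [h2] at h1
    refine h1.congr' ?_
    filter_upwards [eventually_ne_cobounded (0 : ℂ), eventually_ne_cobounded y₀] with y hy hy'
    have h3 : y - y₀ ≠ 0 := sub_ne_zero.2 hy'
    have h4 : φ y = c * (y - y₀) * G y + φ y₀ := sub_eq_iff_eq_add.1 (hGmul y).symm
    have h5 : 1 - y₀ * y⁻¹ ≠ 0 := by
      rwa [← div_eq_mul_inv, one_sub_div hy, ne_eq, div_eq_zero_iff, not_or, and_iff_left hy]
    rw [div_eq_iff (mul_ne_zero hc h5), h4]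
    field_simp
    ring
  -- `G` transported to the unit disc by `t = 1 / φ y`; the centre corresponds to infinity, hence
  -- the value `1`.
  set h : ℂ → ℂ := Function.update (fun t => G (ψ t⁻¹)) 0 1 with hh
  have hinv : ∀ t ∈ Metric.ball (0 : ℂ) 1, t ≠ 0 → ∃ y ∈ Ωᶜ, φ y = t⁻¹ := by
    intro t ht ht0
    have : t⁻¹ ∈ {w : ℂ | 1 < ‖w‖} := by
      rw [mem_ball_zero_iff] at ht
      rw [mem_ofPred_eq, norm_inv]
      exact (one_lt_inv₀ (norm_pos_iff.2 ht0)).2 ht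
    exact hφ.bijOn.surjOn this
  have hφ0 : ∀ y ∈ Ωᶜ, φ y ≠ 0 ∧ (φ y)⁻¹ ∈ Metric.ball (0 : ℂ) 1 := by
    intro y hy
    have h1 : 1 < ‖φ y‖ := hφ.bijOn.mapsTo hy
    refine ⟨norm_pos_iff.1 (one_pos.trans h1), ?_⟩
    rw [mem_ball_zero_iff, norm_inv]
    exact inv_lt_one_of_one_lt₀ h1
  have hcomp : ∀ y ∈ Ωᶜ, DifferentiableAt ℂ (fun w => G (ψ w)) (φ y) := by
    intro y hy
    refine DifferentiableAt.comp (g := G) (φ y) ?_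
      (analyticAt_leftInvOn hU hφ.differentiableOn hψφ hy).differentiableAt
    rw [hψφ hy]
    exact hGd.differentiableAt (hU.mem_nhds hy)
  have hhd : DifferentiableOn ℂ h (Metric.ball 0 1) := by
    intro t ht
    refine DifferentiableAt.differentiableWithinAt ?_
    rcases eq_or_ne t 0 with rfl | ht0
    · refine (analyticAt_update_inv ?_ (hGlim.comp (tendsto_invFunOn hΩ hφ))).differentiableAt
      filter_upwards [tendsto_norm_cobounded_atTop.eventually (eventually_gt_atTop 1)] with w hw
      obtain ⟨y, hy, rfl⟩ := hφ.bijOn.surjOn hw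
      exact hcomp y hy
    · obtain ⟨y, hy, hyt⟩ := hinv t ht ht0
      have h1 : DifferentiableAt ℂ (fun t => G (ψ t⁻¹)) t :=
        DifferentiableAt.comp (g := fun w => G (ψ w)) t (hyt ▸ hcomp y hy)
          (differentiableAt_inv ht0)
      refine h1.congr_of_eventuallyEq ?_
      filter_upwards [isOpen_ne.mem_nhds ht0] with s hs
      rw [hh, Function.update_of_ne hs]
  have hhG : ∀ y ∈ Ωᶜ, h (φ y)⁻¹ = G y := by
    intro y hy
    rw [hh, Function.update_of_ne (inv_ne_zero (hφ0 y hy).1), inv_inv, hψφ hy]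
  have hh0 : ∀ t ∈ Metric.ball (0 : ℂ) 1, h t ≠ 0 := by
    intro t ht
    rcases eq_or_ne t 0 with rfl | ht0
    · simp [hh]
    · obtain ⟨y, hy, hyt⟩ := hinv t ht ht0
      rw [← inv_inv t, ← hyt, hhG y hy]
      exact hG0 y hy
  obtain ⟨H, hHd, hH0, hH⟩ := exists_pow_eq_on_ball one_pos hhd hh0 (by simp [hh]) hn
  have hpow : ∀ y ∈ Ωᶜ, H (φ y)⁻¹ ^ n = G y := fun y hy => by
    rw [hH _ (hφ0 y hy).2, hhG y hy]
  refine ⟨fun y => H (φ y)⁻¹, ?_, ?_, ?_, ?_⟩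
  · exact hHd.comp (hφ.differentiableOn.inv fun y hy => (hφ0 y hy).1) fun y hy => (hφ0 y hy).2
  · intro y hy h0
    refine hG0 y hy ?_
    rw [← hpow y hy]
    simp only [h0, zero_pow hn]
  · intro y hy
    rw [hpow y hy, hGmul]
  · have h1 : (fun t => H t - 1) =O[𝓝 0] fun t => t := by
      have := (hHd.differentiableAt (Metric.ball_mem_nhds 0 one_pos)).isBigO_sub
      simpa [hH0] using this
    refine (h1.comp_tendsto (tendsto_inv₀_cobounded.comp hφ.tendsto_cobounded)).trans ?_
    have h2 : (fun y => (φ y)⁻¹) =O[cobounded ℂ] fun y => y⁻¹ := by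
      simpa using isBigO_inv_of_tendsto_div (k := 1) hc (by simpa using hφ.tendsto_div)
    exact h2

end IsExteriorRiemannMap

/-! ### The cyclic sequence, its foci and its lemniscatic domain -/

section CyclicSequence

variable {n : ℕ} {a : Fin n → ℂ}

theorem cyclicSequence_eq_iff (hn : 0 < n) (ha : Function.Injective a) (i : ℕ) (j : Fin n) :
    cyclicSequence hn a i = a j ↔ i ≡ j [MOD n] := by
  rw [cyclicSequence, ha.eq_iff, Fin.ext_iff, Nat.ModEq, Nat.mod_eq_of_lt j.2]

theorem abs_card_cyclicSequence_sub_le (hn : 0 < n) (ha : Function.Injective a) (j : Fin n)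
    (k : ℕ) :
    |(Nat.card {i : ℕ // i < k ∧ cyclicSequence hn a i = a j} : ℝ) - k * (1 / n)| ≤ 1 := by
  have hcard : Nat.card {i : ℕ // i < k ∧ cyclicSequence hn a i = a j}
      = k.count (· ≡ j [MOD n]) := by
    rw [Nat.count_eq_card_filter_range]
    refine Nat.subtype_card _ fun i => ?_
    rw [Finset.mem_filter, Finset.mem_range, cyclicSequence_eq_iff]
    exact ha
  have hn' : (0 : ℝ) < n := by exact_mod_cast hn
  have hk : (k : ℝ) = n * (k / n : ℕ) + (k % n : ℕ) := by exact_mod_cast (Nat.div_add_mod k n).symm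
  have hlt : ((k % n : ℕ) : ℝ) / n < 1 :=
    (div_lt_one hn').2 (by exact_mod_cast Nat.mod_lt k hn)
  have hnn : 0 ≤ ((k % n : ℕ) : ℝ) / n := by positivity
  have hdiv : (k : ℝ) * (1 / n) = (k / n : ℕ) + ((k % n : ℕ) : ℝ) / n := by
    rw [hk]
    field_simp
  rw [hcard, Nat.count_modEq_card k hn, hdiv, abs_le]
  push_cast
  split_ifs <;> constructor <;> norm_num <;> linarith

theorem prod_sub_cyclicSequence (hn : 0 < n) (a : Fin n → ℂ) (k : ℕ) (w : ℂ) :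
    ∏ i ∈ Finset.range (k * n), (w - cyclicSequence hn a i) = (∏ j, (w - a j)) ^ k := by
  induction k with
  | zero => simp
  | succ k ih =>
    rw [Nat.succ_mul, Finset.prod_range_add, ih, pow_succ, Finset.prod_range]
    congr 1
    refine Finset.prod_congr rfl fun j _ => ?_
    rw [cyclicSequence]
    congr 2
    refine Fin.ext ?_
    simp only [Nat.mul_add_mod_self_right, Nat.mod_eq_of_lt j.2]

theorem prod_sub_eq_pow_sub (hn : 0 < n) (ha : Function.Injective a) {β : ℂ}
    (hβ : ∀ j, a j ^ n = β) (w : ℂ) : ∏ j, (w - a j) = w ^ n - β := by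
  have hmonic : (X ^ n - C β : ℂ[X]).Monic := monic_X_pow_sub_C β hn.ne'
  have hcard : (Finset.univ.map ⟨a, ha⟩).card = n := by simp
  have hroots : (X ^ n - C β : ℂ[X]).roots = (Finset.univ.map ⟨a, ha⟩).val := by
    refine roots_eq_of_natDegree_le_card_of_ne_zero (fun x hx => ?_) ?_ hmonic.ne_zero
    · obtain ⟨j, -, rfl⟩ := Finset.mem_map.1 hx
      simp [hβ j]
    · rw [natDegree_X_pow_sub_C, hcard]
  have h := prod_multiset_X_sub_C_of_monic_of_roots_card_eq hmonic
    (by rw [hroots, natDegree_X_pow_sub_C]; exact hcard)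
  have hprod : ∏ x ∈ Finset.univ.map ⟨a, ha⟩, (X - C x) = X ^ n - C β := by
    rwa [hroots] at h
  have h' := congrArg (eval w) hprod
  rw [Finset.prod_map, eval_prod] at h'
  simpa using h'

theorem isAdmissibleSequence_cyclicSequence (hn : 0 < n) (ha : Function.Injective a) :
    IsAdmissibleSequence a (fun _ => 1 / (n : ℝ)) (cyclicSequence hn a) :=
  ⟨fun _ => ⟨_, rfl⟩, 1, one_pos, fun j k _ => abs_card_cyclicSequence_sub_le hn ha j k⟩

theorem eq_zero_of_forall_abs_natCast_mul_le {x B : ℝ} (h : ∀ k : ℕ, 1 ≤ k → |k * x| ≤ B) :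
    x = 0 := by
  by_contra hx
  have hx' := abs_pos.2 hx
  obtain ⟨k, hk⟩ := exists_nat_gt (max 1 (B / |x|))
  have h1 := h k (by exact_mod_cast ((le_max_left _ _).trans hk.le))
  rw [abs_mul, Nat.abs_cast] at h1
  exact absurd h1 (not_le.2 ((div_lt_iff₀ hx').1 ((le_max_right _ _).trans_lt hk)))

/-- If a periodic sequence is admissible, then the foci are its values, with equal exponents. -/
theorem IsAdmissibleSequence.exists_equiv (hn : 0 < n) (ha : Function.Injective a) {N : ℕ}
    {a' : Fin N → ℂ} {m : Fin N → ℝ} (ha' : Function.Injective a') (hm : ∀ j, 0 < m j)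
    (h : IsAdmissibleSequence a' m (cyclicSequence hn a)) :
    ∃ e : Fin N ≃ Fin n, ∀ j, a' j = a (e j) ∧ m j = 1 / n := by
  obtain ⟨hmem, A, hA, hcount⟩ := h
  have hocc : ∀ j, ∃ l, a' j = a l := by
    intro j
    by_contra! hne
    -- A focus that never occurs has count `0`, so `k * m j` would stay bounded.
    refine (hm j).ne' (eq_zero_of_forall_abs_natCast_mul_le (B := A) fun k hk => ?_)
    have h1 := hcount j k hk
    have : IsEmpty {i : ℕ // i < k ∧ cyclicSequence hn a i = a' j} :=
      ⟨fun i => hne _ i.2.2.symm⟩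
    rwa [Nat.card_of_isEmpty, Nat.cast_zero, zero_sub, abs_neg] at h1
  choose e he using hocc
  have hbij : Function.Bijective e := by
    constructor
    · intro i j hij
      exact ha' (by rw [he i, he j, hij])
    · intro l
      obtain ⟨j, hj⟩ := hmem l
      refine ⟨j, ha ?_⟩
      rw [← he j, ← hj, cyclicSequence_eq_iff hn ha]
  refine ⟨Equiv.ofBijective e hbij, fun j => ⟨he j, ?_⟩⟩
  rw [← sub_eq_zero]
  -- The same count is within `A` of `k * m j` and within `1` of `k / n`.
  refine eq_zero_of_forall_abs_natCast_mul_le (B := A + 1) fun k hk => ?_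
  have h1 := hcount j k hk
  have h2 := abs_card_cyclicSequence_sub_le hn ha (e j) k
  rw [← he j] at h2
  rw [abs_le] at h1 h2 ⊢
  constructor <;> linarith [h1.1, h1.2, h2.1, h2.2]

theorem lemniscaticDomain_eq (hn : 0 < n) (ha : Function.Injective a) {β : ℂ}
    (hβ : ∀ j, a j ^ n = β) {N : ℕ} {a' : Fin N → ℂ} {m : Fin N → ℝ} (e : Fin N ≃ Fin n)
    (he : ∀ j, a' j = a (e j) ∧ m j = 1 / n) {μ : ℝ} (hμ : 0 < μ) :
    lemniscaticDomain a' m μ = {w | μ ^ n < ‖w ^ n - β‖} := by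
  ext w
  have h1 : ∏ j, ‖w - a' j‖ ^ m j = ‖w ^ n - β‖ ^ (n : ℝ)⁻¹ := by
    rw [← prod_sub_eq_pow_sub hn ha hβ, norm_prod,
      ← Real.finsetProd_rpow _ _ fun _ _ => norm_nonneg _]
    refine Fintype.prod_equiv e _ _ fun j => ?_
    rw [(he j).1, (he j).2, one_div]
  rw [lemniscaticDomain, mem_ofPred_eq, mem_ofPred_eq, h1,
    ← pow_lt_pow_iff_left₀ hμ.le (by positivity) hn.ne',
    Real.rpow_inv_natCast_pow (norm_nonneg _) hn.ne']

end CyclicSequence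

/-! ### The lemniscatic map of the preimage -/

section Preimage

variable {Ω : Set ℂ} {φ : ℂ → ℂ} {c : ℝ} {n : ℕ} {α α₀ : ℝ} {P : ℂ[X]}

theorem tendsto_eval_div_pow (hn : 0 < n) (hP : P = C (α : ℂ) * X ^ n + C (α₀ : ℂ)) :
    Tendsto (fun z => P.eval z / z ^ n) (cobounded ℂ) (𝓝 α) := by
  have h : Tendsto (fun z : ℂ => (α : ℂ) + α₀ * z⁻¹ ^ n) (cobounded ℂ) (𝓝 (α + α₀ * 0 ^ n)) :=
    tendsto_const_nhds.add ((tendsto_inv₀_cobounded.pow n).const_mul _)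
  rw [zero_pow hn.ne', mul_zero, add_zero] at h
  refine h.congr' ?_
  filter_upwards [eventually_ne_cobounded (0 : ℂ)] with z hz
  rw [hP]
  simp only [eval_add, eval_mul, eval_C, eval_pow, eval_X]
  rw [add_div, mul_div_cancel_right₀ _ (pow_ne_zero n hz), inv_pow, div_eq_mul_inv (α₀ : ℂ)]

theorem tendsto_eval_cobounded (hn : 0 < n) (hα : 0 < α)
    (hP : P = C (α : ℂ) * X ^ n + C (α₀ : ℂ)) : Tendsto P.eval (cobounded ℂ) (cobounded ℂ) := by
  rw [← tendsto_norm_atTop_iff_cobounded]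
  exact P.tendsto_norm_atTop (degree_C_mul_X_pow_add_C_pos hn hα hP) tendsto_norm_cobounded_atTop

theorem isBigO_inv_pow_cobounded {j k : ℕ} (h : j ≤ k) :
    (fun z : ℂ => (z ^ k)⁻¹) =O[cobounded ℂ] fun z => (z ^ j)⁻¹ := by
  refine Asymptotics.IsBigO.of_bound 1 ?_
  filter_upwards [tendsto_norm_cobounded_atTop.eventually (eventually_ge_atTop 1)] with z hz
  rw [one_mul, norm_inv, norm_inv, norm_pow, norm_pow]
  exact inv_anti₀ (by positivity) (pow_le_pow_right₀ hz h)

theorem isBigO_inv_eval (hn : 0 < n) (hα : 0 < α) (hP : P = C (α : ℂ) * X ^ n + C (α₀ : ℂ)) :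
    (fun z => (P.eval z)⁻¹) =O[cobounded ℂ] fun z => (z ^ n)⁻¹ :=
  isBigO_inv_of_tendsto_div (Complex.ofReal_ne_zero.2 hα.ne') (tendsto_eval_div_pow hn hP)

theorem tendsto_comp_eval_div_pow (hφ : IsExteriorRiemannMap Ω φ c) (hn : 0 < n) (hα : 0 < α)
    (hP : P = C (α : ℂ) * X ^ n + C (α₀ : ℂ)) :
    Tendsto (fun z => φ (P.eval z) / z ^ n) (cobounded ℂ) (𝓝 (α * c)) := by
  have htop := tendsto_eval_cobounded hn hα hP
  rw [mul_comm]
  refine ((hφ.tendsto_div.comp htop).mul (tendsto_eval_div_pow hn hP)).congr' ?_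
  filter_upwards [htop.eventually (eventually_ne_cobounded (0 : ℂ))] with z hz
  exact div_mul_div_cancel₀ hz

theorem IsLemniscaticMap.tendsto_div {E : Set ℂ} {N : ℕ} {a : Fin N → ℂ} {m : Fin N → ℝ} {μ : ℝ}
    {Φ : ℂ → ℂ} (h : IsLemniscaticMap E a m μ Φ) :
    Tendsto (fun z => Φ z / z) (cobounded ℂ) (𝓝 1) := by
  have h1 : Tendsto (fun z => Φ z - z) (cobounded ℂ) (𝓝 0) :=
    h.isBigO.trans_tendsto tendsto_inv₀_cobounded
  have h2 := (h1.mul tendsto_inv₀_cobounded).const_add 1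
  rw [mul_zero, add_zero] at h2
  refine h2.congr' ?_
  filter_upwards [eventually_ne_cobounded (0 : ℂ)] with z hz
  field_simp
  ring

theorem isCompact_of_isLemniscaticMap {E : Set ℂ} {N : ℕ} {a : Fin N → ℂ} {m : Fin N → ℝ} {μ : ℝ}
    {Φ : ℂ → ℂ} (h : IsLemniscaticMap E a m μ Φ) : IsCompact E := by
  obtain ⟨K, hK, -, -, rfl⟩ := h.components
  exact isCompact_iUnion fun j => (hK j).isCompact

/-- A lemniscatic map of the preimage of `Ω` whose foci are the `n`-th roots of `β` is an `n`-th
root of an affine function of the exterior Riemann mapping of `Ω`. -/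
theorem pow_sub_eq_of_lemniscaticDomain_eq (hΩ : IsSimplyConnectedCompact Ω)
    (hφ : IsExteriorRiemannMap Ω φ c) (hn : 0 < n) (hα : 0 < α) (hα₀ : (α₀ : ℂ) ∉ Ω)
    (hP : P = C (α : ℂ) * X ^ n + C (α₀ : ℂ)) {N : ℕ} {a : Fin N → ℂ} {m : Fin N → ℝ} {μ : ℝ}
    {Φ : ℂ → ℂ} (h : IsLemniscaticMap {z | P.eval z ∈ Ω} a m μ Φ) {β : ℂ}
    (hdom : lemniscaticDomain a m μ = {w | μ ^ n < ‖w ^ n - β‖}) :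
    ∀ z, P.eval z ∉ Ω → Φ z ^ n - β = (1 / (α * c)) * φ (P.eval z) := by
  have hc := hφ.ofReal_ne_zero
  have hα' : (α : ℂ) ≠ 0 := Complex.ofReal_ne_zero.2 hα.ne'
  set E : Set ℂ := {z | P.eval z ∈ Ω} with hE
  have hEc : IsCompact E := isCompact_of_isLemniscaticMap h
  have hEne : E.Nonempty := by
    obtain ⟨y, hy⟩ := hΩ.isConnected.nonempty
    obtain ⟨z, rfl⟩ := (P.isOpenQuotientMap_eval (natDegree_pos_iff_degree_pos.2
      (degree_C_mul_X_pow_add_C_pos hn hα hP)).ne').surjective y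
    exact ⟨z, hy⟩
  have hμn : 0 < μ ^ n := pow_pos h.mu_pos n
  have hmaps : MapsTo P.eval Eᶜ Ωᶜ := fun z hz => hz
  have hnorm : ∀ z ∈ Eᶜ, μ ^ n < ‖Φ z ^ n - β‖ := fun z hz => by
    have := h.bijOn.mapsTo hz
    rwa [hdom] at this
  have hnorm' : ∀ z ∈ Eᶜ, 1 < ‖φ (P.eval z)‖ := fun z hz => hφ.bijOn.mapsTo (hmaps hz)
  have hφ0 : ∀ z ∈ Eᶜ, φ (P.eval z) ≠ 0 := fun z hz =>
    norm_pos_iff.1 (one_pos.trans (hnorm' z hz))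
  have hd : DifferentiableOn ℂ (fun z => φ (P.eval z)) Eᶜ :=
    hφ.differentiableOn.comp P.differentiable.differentiableOn hmaps
  -- Numerator and denominator have constant boundary moduli, `μ ^ n` and `1`, and growth of the
  -- same order `z ^ n`, so this quotient satisfies the hypotheses of
  -- `eqOn_of_tendsto_norm_boundary`.
  have hq : DifferentiableOn ℂ (fun z => (Φ z ^ n - β) / φ (P.eval z)) Eᶜ :=
    ((h.differentiableOn.pow n).sub_const β).div hd hφ0
  have hlim : Tendsto (fun z => (Φ z ^ n - β) / φ (P.eval z)) (cobounded ℂ)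
      (𝓝 (1 / (α * c))) := by
    have h1 : Tendsto (fun z => (Φ z / z) ^ n - β * z⁻¹ ^ n) (cobounded ℂ)
        (𝓝 (1 ^ n - β * 0 ^ n)) :=
      (h.tendsto_div.pow n).sub ((tendsto_inv₀_cobounded.pow n).const_mul β)
    rw [zero_pow hn.ne', one_pow, mul_zero, sub_zero] at h1
    refine (h1.div (tendsto_comp_eval_div_pow hφ hn hα hP) (mul_ne_zero hα' hc)).congr' ?_
    filter_upwards [eventually_ne_cobounded (0 : ℂ)] with z hz
    rw [Pi.div_apply, div_pow, inv_pow, ← div_eq_mul_inv, ← sub_div,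
      div_div_div_cancel_right₀ (pow_ne_zero n hz)]
  have hbd : ∀ e ∈ E, Tendsto (fun z => ‖(Φ z ^ n - β) / φ (P.eval z)‖) (𝓝[Eᶜ] e)
      (𝓝 (μ ^ n)) := by
    intro e he
    have h1 : Tendsto (fun z => ‖Φ z ^ n - β‖) (𝓝[Eᶜ] e) (𝓝 (μ ^ n)) :=
      tendsto_of_image_eq_setOf_lt (u := fun w => ‖w ^ n - β‖) hEc one_ne_zero
        h.differentiableOn h.bijOn.injOn h.tendsto_div (by fun_prop)
        (h.bijOn.image_eq.trans hdom) he
    have h2 : Tendsto (fun y => ‖φ y‖) (𝓝[Ωᶜ] P.eval e) (𝓝 1) :=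
      tendsto_of_image_eq_setOf_lt (u := fun w => ‖w‖) hΩ.isCompact hc
        hφ.differentiableOn hφ.bijOn.injOn hφ.tendsto_div (by fun_prop) hφ.bijOn.image_eq he
    have h3 : Tendsto P.eval (𝓝[Eᶜ] e) (𝓝[Ωᶜ] P.eval e) :=
      P.continuous.continuousWithinAt.tendsto_nhdsWithin hmaps
    have h4 := h1.div (h2.comp h3) one_ne_zero
    rw [div_one] at h4
    exact h4.congr fun z => (norm_div _ _).symm
  intro z hz
  have h1 := eqOn_of_tendsto_norm_boundary hEc hEne
    (isPreconnected_compl_preimage hΩ hn hα hα₀ hP) hq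
    (fun z hz => div_ne_zero (norm_pos_iff.1 (hμn.trans (hnorm z hz))) (hφ0 z hz))
    (one_div_ne_zero (mul_ne_zero hα' hc)) hlim hμn hbd z hz
  exact (div_eq_iff (hφ0 z hz)).1 h1

theorem exists_isLemniscaticMap_preimage (hΩ : IsSimplyConnectedCompact Ω)
    (hΩ_nontrivial : Ω.Nontrivial) (hφ : IsExteriorRiemannMap Ω φ c) (hn : 2 ≤ n) (hα : 0 < α)
    (hα₀ : ∀ x : ℝ, (x : ℂ) ∈ Ω → α₀ < x) (hP : P = C (α : ℂ) * X ^ n + C (α₀ : ℂ)) {μ : ℝ}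
    (hμ : 0 < μ) (hμn : μ ^ n = 1 / (α * c)) {a : Fin n → ℂ} (ha : Function.Injective a)
    (hβ : ∀ j, a j ^ n = -(μ ^ n * φ α₀)) :
    ∃ Φ : ℂ → ℂ, IsLemniscaticMap {z | P.eval z ∈ Ω} a (fun _ => 1 / (n : ℝ)) μ Φ := by
  have hn0 : 0 < n := by omega
  have hc := hφ.ofReal_ne_zero
  have hα' : (α : ℂ) ≠ 0 := Complex.ofReal_ne_zero.2 hα.ne'
  have hα₀Ω : (α₀ : ℂ) ∈ Ωᶜ := fun h => lt_irrefl _ (hα₀ α₀ h)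
  have hμC : (μ : ℂ) ^ n = 1 / (α * c) := by exact_mod_cast hμn
  have hμ0 : (μ : ℂ) ^ n ≠ 0 := pow_ne_zero n (Complex.ofReal_ne_zero.2 hμ.ne')
  obtain ⟨g, hgd, hg0, hg, hgO⟩ := hφ.exists_root_slope hΩ.isCompact hα₀Ω hn0.ne'
  have hPeval : ∀ z, P.eval z = α * z ^ n + α₀ := fun z => by rw [hP]; simp
  set E : Set ℂ := {z | P.eval z ∈ Ω} with hE
  -- The factor `z` is the `n`-th root of `(P z - α₀) / α`, so no branch has to be chosen. At `z =
  -- 0` the identity `hpow` forces the constant `-(μ ^ n * φ α₀)`.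
  set Φ : ℂ → ℂ := fun z => z * g (P.eval z) with hΦ
  have hmaps : MapsTo P.eval Eᶜ Ωᶜ := fun z hz => hz
  have hpow : ∀ z ∈ Eᶜ, Φ z ^ n - -(μ ^ n * φ α₀) = μ ^ n * φ (P.eval z) := by
    intro z hz
    have h1 : c * (P.eval z - α₀) * g (P.eval z) ^ n = φ (P.eval z) - φ α₀ := hg _ (hmaps hz)
    have h2 : P.eval z - α₀ = α * z ^ n := by rw [hPeval, add_sub_cancel_right]
    rw [h2] at h1
    have h3 : Φ z ^ n = μ ^ n * (φ (P.eval z) - φ α₀) := by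
      rw [← h1, hμC, hΦ, mul_pow]
      field_simp
    rw [h3]
    ring
  have hdom : lemniscaticDomain a (fun _ => 1 / (n : ℝ)) μ
      = {w | μ ^ n < ‖w ^ n - -(μ ^ n * φ α₀)‖} :=
    lemniscaticDomain_eq hn0 ha hβ (Equiv.refl _) (fun j => ⟨rfl, rfl⟩) hμ
  refine ⟨Φ, exists_components_preimage hΩ hΩ_nontrivial hn0 hα hα₀ hP, ha,
    fun j => by positivity, ?_, hμ, ?_, ?_, ?_⟩
  · simp [hn0.ne']
  · exact differentiableOn_id.mul (hgd.comp P.differentiable.differentiableOn hmaps)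
  · rw [hdom]
    refine ⟨fun z hz => ?_, fun z hz z' hz' h => ?_, fun w hw => ?_⟩
    · rw [mem_ofPred_eq, hpow z hz, norm_mul, norm_pow, Complex.norm_real, Real.norm_eq_abs,
        abs_of_pos hμ]
      exact lt_mul_of_one_lt_right (pow_pos hμ n) (hφ.bijOn.mapsTo (hmaps hz))
    · have h1 := hpow z hz
      rw [h, hpow z' hz'] at h1
      have h2 : P.eval z' = P.eval z := hφ.bijOn.injOn (hmaps hz') (hmaps hz) (mul_left_cancel₀ hμ0 h1)
      simp only [hΦ] at h
      rw [h2] at h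
      exact mul_right_cancel₀ (hg0 _ (hmaps hz)) h
    · have hw1 : (w ^ n - -(μ ^ n * φ α₀)) / μ ^ n ∈ {w : ℂ | 1 < ‖w‖} := by
        rw [mem_ofPred_eq, norm_div, norm_pow, Complex.norm_real, Real.norm_eq_abs, abs_of_pos hμ]
        exact (one_lt_div (pow_pos hμ n)).2 hw
      obtain ⟨y, hy, hyw⟩ := hφ.bijOn.surjOn hw1
      obtain ⟨z, rfl⟩ := (P.isOpenQuotientMap_eval (natDegree_pos_iff_degree_pos.2
        (degree_C_mul_X_pow_add_C_pos hn0 hα hP)).ne').surjective y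
      -- `Φ` commutes with rotation by `n`-th roots of unity, so rotating `z` by `w / Φ z` reaches
      -- `w` itself.
      have hzw : Φ z ^ n = w ^ n := by
        have h1 := hpow z hy
        rw [hyw, mul_div_cancel₀ _ hμ0] at h1
        exact sub_left_injective h1
      rcases eq_or_ne (Φ z) 0 with h0 | h0
      · refine ⟨z, hy, ?_⟩
        rw [h0, zero_pow hn0.ne'] at hzw
        rw [h0, eq_comm]
        exact pow_eq_zero_iff hn0.ne' |>.1 hzw.symm
      · have hrot : P.eval (w / Φ z * z) = P.eval z := by
          rw [hPeval, hPeval, mul_pow, div_pow, ← hzw, div_self (pow_ne_zero n h0), one_mul]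
        refine ⟨w / Φ z * z, ?_, ?_⟩
        · rw [mem_compl_iff, hE, mem_ofPred_eq, hrot]
          exact hy
        · have : Φ (w / Φ z * z) = w / Φ z * Φ z := by
            change w / Φ z * z * g (P.eval (w / Φ z * z)) = w / Φ z * (z * g (P.eval z))
            rw [hrot, mul_assoc]
          rw [this, div_mul_cancel₀ _ h0]
  -- Here `Φ z - z = z * O(z⁻ⁿ)`; `2 ≤ n` is exactly what makes this `O(1 / z)`.
  · have h1 := (hgO.comp_tendsto (tendsto_eval_cobounded hn0 hα hP)).trans
      ((isBigO_inv_eval hn0 hα hP).trans (isBigO_inv_pow_cobounded hn))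
    refine ((Asymptotics.isBigO_refl (fun z : ℂ => z) (cobounded ℂ)).mul h1).congr' ?_ ?_
    · filter_upwards with z
      simp only [hΦ, Function.comp_apply]
      ring
    · filter_upwards [eventually_ne_cobounded (0 : ℂ)] with z hz
      field_simp

end Preimage

/-! ### Faber and Faber–Walsh polynomials -/

theorem Polynomial.eq_of_forall_eval_eq_of_ball {K : Set ℂ} (hK : IsCompact K) {F G : ℂ[X]}
    (h : ∀ (z : ℂ) (R : ℝ), K ⊆ Metric.ball 0 R → z ∈ Metric.ball (0 : ℂ) R →
      F.eval z = G.eval z) : F = G := by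
  refine Polynomial.funext fun z => ?_
  obtain ⟨R, hR⟩ := (hK.isBounded.union isBounded_singleton).subset_ball (0 : ℂ) (s := K ∪ {z})
  exact h z R (subset_union_left.trans hR) (hR (Or.inr rfl))

theorem IsExteriorRiemannMap.exists_isBigO_pow_sub {Ω : Set ℂ} {φ : ℂ → ℂ} {c : ℝ}
    (hΩ : IsCompact Ω) (hφ : IsExteriorRiemannMap Ω φ c) (k : ℕ) :
    ∃ F : ℂ[X], (fun z => φ z ^ k - F.eval z) =O[cobounded ℂ] fun z => z⁻¹ := by
  refine exists_polynomial_isBigO hΩ (hφ.differentiableOn.pow k) (k := k) (c := c ^ k) ?_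
  exact (hφ.tendsto_div.pow k).congr fun z => div_pow _ _ _

theorem isFaberPolynomial_of_isBigO {Ω : Set ℂ} {φ : ℂ → ℂ} {c : ℝ} (hΩ : IsCompact Ω)
    (hφ : IsExteriorRiemannMap Ω φ c) {k : ℕ} {F : ℂ[X]}
    (hF : (fun z => φ z ^ k - F.eval z) =O[cobounded ℂ] fun z => z⁻¹) :
    IsFaberPolynomial Ω φ k F := fun _ _ hR hz =>
  (circleIntegral_eq_eval_of_isBigO hΩ (hφ.differentiableOn.pow k) hF hR hz).symm

theorem mainTheorem2
    (Ω : Set ℂ) (hΩ : IsSimplyConnectedCompact Ω) (hΩ_nontrivial : Ω.Nontrivial)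
    (hΩ_symm : (starRingEnd ℂ) '' Ω = Ω)
    (φ : ℂ → ℂ) (c : ℝ) (hφ : IsExteriorRiemannMap Ω φ c)
    (n : ℕ) (hn : 2 ≤ n) (α α₀ : ℝ) (hα : 0 < α) (hα₀ : ∀ x : ℝ, (x : ℂ) ∈ Ω → α₀ < x)
    (P : ℂ[X]) (hP : P = C (α : ℂ) * X ^ n + C (α₀ : ℂ))
    (E : Set ℂ) (hE : E = {z : ℂ | P.eval z ∈ Ω})
    (μ : ℝ) (hμ : μ = (1 / (α * c)) ^ (1 / (n : ℝ)))
    (a : Fin n → ℂ) (ha_inj : Function.Injective a)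
    (ha_root : ∀ j, a j ^ n + (μ : ℂ) ^ n * φ (P.eval 0) = 0) :
    ∀ k : ℕ, (∃ F : ℂ[X], IsFaberPolynomial Ω φ k F) ∧
      ∀ F : ℂ[X], IsFaberPolynomial Ω φ k F →
        ∀ b : ℂ[X],
          IsFaberWalshPolynomial E (cyclicSequence (by omega : 0 < n) a) (k * n) b ↔
            b = C (1 / ((α : ℂ) * (c : ℂ)) ^ k) * F.comp P := by
  intro k
  have hn0 : 0 < n := by omega
  have hΩc := hΩ.isCompact
  obtain ⟨F₀, hF₀⟩ := hφ.exists_isBigO_pow_sub hΩc k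
  have hF₀' := isFaberPolynomial_of_isBigO hΩc hφ hF₀
  refine ⟨⟨F₀, hF₀'⟩, fun F hF b => ?_⟩
  obtain rfl : F = F₀ := Polynomial.eq_of_forall_eval_eq_of_ball hΩc fun z R hR hz =>
    (hF z R hR hz).trans (hF₀' z R hR hz).symm
  subst hE
  have hEc : IsCompact {z | P.eval z ∈ Ω} :=
    isCompact_preimage_eval hΩc (degree_C_mul_X_pow_add_C_pos hn0 hα hP)
  have hα₀Ω : (α₀ : ℂ) ∉ Ω := fun h => lt_irrefl _ (hα₀ α₀ h)
  have hpos : 0 < 1 / (α * c) := one_div_pos.2 (mul_pos hα hφ.pos)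
  have hμ0 : 0 < μ := hμ ▸ Real.rpow_pos_of_pos hpos _
  have hμn : μ ^ n = 1 / (α * c) := by
    rw [hμ, one_div (n : ℝ), Real.rpow_inv_natCast_pow hpos.le hn0.ne']
  have hβ : ∀ j, a j ^ n = -(μ ^ n * φ α₀) := by
    intro j
    have hP0 : P.eval 0 = α₀ := by rw [hP]; simp [hn0.ne']
    rw [← hP0]
    exact eq_neg_of_add_eq_zero_left (ha_root j)
  -- Proved for every lemniscatic map and every `ν`, so both directions of the equivalence follow
  -- without uniqueness of the lemniscatic map.
  have key : ∀ (N : ℕ) (a' : Fin N → ℂ) (m : Fin N → ℝ) (ν : ℝ) (Φ : ℂ → ℂ),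
      IsLemniscaticMap {z | P.eval z ∈ Ω} a' m ν Φ →
      IsAdmissibleSequence a' m (cyclicSequence hn0 a) →
      ∀ (z : ℂ) (R : ℝ), {z | P.eval z ∈ Ω} ⊆ Metric.ball 0 R → z ∈ Metric.ball (0 : ℂ) R →
        (2 * (Real.pi : ℂ) * Complex.I)⁻¹ * (∮ ζ in C(0, R),
          (∏ i ∈ Finset.range (k * n), (Φ ζ - cyclicSequence hn0 a i)) / (ζ - z))
          = (C (1 / ((α : ℂ) * (c : ℂ)) ^ k) * F.comp P).eval z := by
    intro N a' m ν Φ hΦ hadm z R hR hz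
    obtain ⟨e, he⟩ := hadm.exists_equiv hn0 ha_inj hΦ.foci_injective hΦ.exponent_pos
    have hrel := pow_sub_eq_of_lemniscaticDomain_eq hΩ hφ hn0 hα hα₀Ω hP hΦ
      (lemniscaticDomain_eq hn0 ha_inj hβ e he hΦ.mu_pos)
    have hprod : ∀ ζ ∈ {z | P.eval z ∈ Ω}ᶜ,
        ∏ i ∈ Finset.range (k * n), (Φ ζ - cyclicSequence hn0 a i)
          = 1 / ((α : ℂ) * (c : ℂ)) ^ k * φ (P.eval ζ) ^ k := by
      intro ζ hζ
      rw [prod_sub_cyclicSequence, prod_sub_eq_pow_sub hn0 ha_inj hβ, hrel ζ hζ, mul_pow,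
        one_div_pow]
    refine circleIntegral_eq_eval_of_isBigO hEc ?_ ?_ hR hz
    · have hd : DifferentiableOn ℂ (fun ζ => 1 / ((α : ℂ) * (c : ℂ)) ^ k * φ (P.eval ζ) ^ k)
          {z | P.eval z ∈ Ω}ᶜ :=
        ((hφ.differentiableOn.comp P.differentiable.differentiableOn
          fun ζ hζ => hζ).pow k).const_mul _
      exact hd.congr hprod
    · have h1 := (hF₀.comp_tendsto (tendsto_eval_cobounded hn0 hα hP)).trans
        ((isBigO_inv_eval hn0 hα hP).trans (isBigO_inv_pow_cobounded (j := 1) hn0))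
      refine (h1.const_mul_left (1 / ((α : ℂ) * (c : ℂ)) ^ k)).congr' ?_ ?_
      · filter_upwards [eventually_mem_compl_cobounded hEc] with ζ hζ
        rw [hprod ζ hζ, eval_mul, eval_C, eval_comp, Function.comp_apply, mul_sub]
      · filter_upwards with ζ
        rw [pow_one]
  constructor
  · rintro ⟨N, a', m, ν, Φ, hΦ, hadm, hb⟩
    exact Polynomial.eq_of_forall_eval_eq_of_ball hEc fun z R hR hz =>
      (hb z R hR hz).trans (key N a' m ν Φ hΦ hadm z R hR hz)
  · rintro rfl
    obtain ⟨Φ, hΦ⟩ := exists_isLemniscaticMap_preimage hΩ hΩ_nontrivial hφ hn hα hα₀ hP hμ0 hμn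
      ha_inj hβ
    have hadm := isAdmissibleSequence_cyclicSequence hn0 ha_inj
    exact ⟨n, a, _, μ, Φ, hΦ, hadm, fun z R hR hz => (key n a _ μ Φ hΦ hadm z R hR hz).symm⟩
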